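/- Let $\mathbb I=[0,1]$, let $\ell\ge 1$ and $d\ge \ell+2$ be integers and $m=d-\ell$ (so $m\ge 2$). A $d$-dimensional copula $C$ is the distribution function on $\mathbb I^d$ of a probability measure $\mu_C$ with uniform univariate marginals; $\mu_{C^{1:j}}$ denotes the marginal of $\mu_C$ in the first $j$ coordinates, and a $j$-Markov kernel $K_C$ of $C$ is a regular conditional distribution of the last $d-j$ coordinates given the first $j$ coordinates under $\mu_C$. A sequence $(C_n)$ of copulas converges $j$-weakly conditionally to $C$ if there is a Borel set $\Lambda\subseteq\mathbb I^j$ with $\mu_{C^{1:j}}(\Lambda)=1$ such that $K_{C_n}(\mathbf s,\cdot)\to K_C(\mathbf s,\cdot)$ weakly for every $\mathbf s\in\Lambda$. For a $p$-dimensional copula $C$, $p\ge 2$, put $$\zeta_1^{p}(C)=3\int_{\mathbb I}\int_{\mathbb I^{p-1}}\bigl|K_C(\mathbf s,[0,y])-y\bigr|\,\mathrm d\mu_{C^{1:p-1}}(\mathbf s)\,\mathrm dy ,$$ where $K_C$ is a $(p-1)$-Markov kernel of $C$. A strict $d$-dimensional Archimedean copula with generator $\psi$ is a copula of the form $C(\mathbf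 z)=\psi(\varphi(z_1)+\dots+\varphi(z_d))$, where $\psi:[0,\infty)\to(0,1]$ is continuous and strictly decreasing with $\psi(0)=1$ and $\lim_{z\to\infty}\psi(z)=0$, $\varphi$ is the inverse of $\psi$, $\varphi(0)=\infty$ and $\psi(\infty)=0$. For such $C$ and $\mathbf x\in(0,1)^\ell$ put $$K_C(\mathbf x,[\mathbf 0,\mathbf y])=\frac{\psi^{(\ell)}\bigl(\sum_{i=1}^\ell\varphi(x_i)+\sum_{j=1}^{m}\varphi(y_j)\bigr)}{\psi^{(\ell)}\bigl(\sum_{i=1}^\ell\varphi(x_i)\bigr)},\qquad \mathbf y\in\mathbb I^{m},$$ with $\psi^{(\ell)}(\infty)=0$. These are the conditional distribution functions, for $\mathbf x\in(0,1)^\ell$, of a version of the $\ell$-Markov kernel of $C$. The conditional copula $C^{\mathbf x}$ is the $m$-dimensional copula of this distribution function, $$C^{\mathbf x}(\mathbf u)=K_C\bigl(\mathbf x,[0,g_{\mathbf x}^{-1}(u_1)]\times\dots\times[0,g_{\mathbf x}^{-1}(u_m)]\bigr),$$ where $g_{\mathbf x}$ is the common univariate margin of $K_C(\mathbf x,\cdot)$,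 and $\zeta_1^{\mathbf x}(C):=\zeta_1^{m}(C^{\mathbf x})$. **Corollary.** Let $C,C_1,C_2,\dots$ be strict $d$-dimensional Archimedean copulas such that $(C_n)_{n\in\mathbb N}$ converges uniformly to $C$. Then for every $\mathbf x\in(0,1)^\ell$ the sequence of conditional copulas $(C_n^{\mathbf x})_{n\in\mathbb N}$ converges $(d-\ell-1)$-weakly conditionally to $C^{\mathbf x}$ (for any choice of versions of the Markov kernels), and $$\lim_{n\to\infty}\bigl|\zeta_1^{\mathbf x}(C_n)-\zeta_1^{\mathbf x}(C)\bigr|=0 .$$ -/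

import Mathlib

open MeasureTheory ProbabilityTheory Filter Topology Set
open scoped unitInterval

namespace ArchCopula

/-! ## Copulas

A `d`-variate function on the unit cube is a map `(Fin d → I) → ℝ`, where `I = [0,1]` is
`unitInterval`; `volume` on `I` is the Lebesgue measure, and `Set.Iic x` in `Fin d → I` is the
rectangle `[0, x] = [0, x₁] × ⋯ × [0, x_d]`. -/

/-- `d`-stochastic measures: probability measures on the cube with uniform univariate margins. -/
structure IsDStochastic {d : ℕ} (μ : Measure (Fin d → I)) : Prop where
  isProbabilityMeasure : IsProbabilityMeasure μ
  map_eval : ∀ i, μ.map (fun z => z i) = (volume : Measure I)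

/-- `C` is a `d`-dimensional copula: the distribution function of a `d`-stochastic measure. -/
def IsCopula {d : ℕ} (C : (Fin d → I) → ℝ) : Prop :=
  ∃ μ : Measure (Fin d → I), IsDStochastic μ ∧ ∀ z, μ.real (Iic z) = C z

open Classical in
/-- The `d`-stochastic measure `μ_C` of a copula `C` (and `0` if `C` is not a copula). -/
noncomputable def copulaMeasure {d : ℕ} (C : (Fin d → I) → ℝ) : Measure (Fin d → I) :=
  if h : IsCopula C then h.choose else 0

theorem IsCopula.isDStochastic {d : ℕ} {C : (Fin d → I) → ℝ} (h : IsCopula C) :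
    IsDStochastic (copulaMeasure C) := by
  rw [copulaMeasure, dif_pos h]
  exact h.choose_spec.1

theorem IsCopula.copulaMeasure_Iic {d : ℕ} {C : (Fin d → I) → ℝ} (h : IsCopula C)
    (z : Fin d → I) : (copulaMeasure C).real (Iic z) = C z := by
  rw [copulaMeasure, dif_pos h]
  exact h.choose_spec.2 z

instance {d : ℕ} (C : (Fin d → I) → ℝ) : IsFiniteMeasure (copulaMeasure C) := by
  by_cases h : IsCopula C
  · have := h.isDStochastic.isProbabilityMeasure
    infer_instance
  · rw [copulaMeasure, dif_neg h]
    infer_instance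

/-! ## Markov kernels of copulas -/

/-- The first `l` coordinates of a point of the `(l + m)`-dimensional cube. -/
def firstBlock {l m : ℕ} (z : Fin (l + m) → I) : Fin l → I := fun i => z (Fin.castAdd m i)

/-- The last `m` coordinates of a point of the `(l + m)`-dimensional cube. -/
def lastBlock {l m : ℕ} (z : Fin (l + m) → I) : Fin m → I := fun j => z (Fin.natAdd l j)

/-- The measure `μ_{C^{1:l}}` of the marginal of `C` in the first `l` coordinates. -/
noncomputable def marginalMeasure {l m : ℕ} (C : (Fin (l + m) → I) → ℝ) :
    Measure (Fin l → I) :=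
  (copulaMeasure C).map firstBlock

/-- `K` is (a version of) the `l`-Markov kernel of the `(l + m)`-dimensional copula `C`: a Markov
kernel that is a regular conditional distribution of the last `m` coordinates given the first `l`
coordinates under `μ_C`. -/
structure IsMarkovKernelOf {l m : ℕ} (C : (Fin (l + m) → I) → ℝ)
    (K : Kernel (Fin l → I) (Fin m → I)) : Prop where
  isMarkovKernel : IsMarkovKernel K
  hasCondDistrib : HasCondDistrib lastBlock firstBlock K (copulaMeasure C)

/-- The probability measure `K x` of a Markov kernel `K`. -/
noncomputable def kernelAt {l m : ℕ} (K : Kernel (Fin l → I) (Fin m → I)) (hK : IsMarkovKernel K)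
    (x : Fin l → I) : ProbabilityMeasure (Fin m → I) :=
  ⟨K x, hK.isProbabilityMeasure x⟩

/-- The `l`-weak conditional convergence of a sequence `Cn` of `(l + m)`-dimensional copulas to
`C`: the conditional distributions `Kn n x` converge weakly to `K x` for `μ_{C^{1:l}}`-almost
every `x`. It is required for every choice of versions `Kn n`, `K` of the `l`-Markov kernels
(versions of the kernel of a copula always exist). -/
def WeaklyConditionallyConverges {l m : ℕ} (Cn : ℕ → (Fin (l + m) → I) → ℝ)
    (C : (Fin (l + m) → I) → ℝ) : Prop :=
  ∀ (Kn : ℕ → Kernel (Fin l → I) (Fin m → I)) (K : Kernel (Fin l → I) (Fin m → I))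
    (hKn : ∀ n, IsMarkovKernelOf (Cn n) (Kn n)) (hK : IsMarkovKernelOf C K),
    ∃ Λ : Set (Fin l → I), MeasurableSet Λ ∧ marginalMeasure C Λ = 1 ∧
      ∀ x ∈ Λ, Tendsto (fun n => kernelAt (Kn n) (hKn n).isMarkovKernel x) atTop
        (𝓝 (kernelAt K hK.isMarkovKernel x))

/-- The dependence measure
`ζ₁(C) = 3 ∫_I ∫_{I^k} |K_C(s, [0,y]) - y| dμ_{C^{1:k}}(s) dλ(y)` of a `(k + 1)`-dimensional
copula `C`. The inner integral does not depend on the version of the `k`-Markov kernel `K_C`;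
the version used is Mathlib's `condDistrib`. -/
noncomputable def zeta1 {k : ℕ} (C : (Fin (k + 1) → I) → ℝ) : ℝ :=
  3 * ∫ y : I, ∫ s : Fin k → I,
    |(condDistrib (lastBlock (l := k) (m := 1)) firstBlock (copulaMeasure C) s).real
        {t : Fin 1 → I | t 0 ≤ y} - (y : ℝ)|
    ∂(marginalMeasure (l := k) (m := 1) C)

/-! ## Archimedean copulas -/

/-- Archimedean generators `ψ : [0,∞) → [0,1]` (the values of `ψ : ℝ → ℝ` at negative arguments
are irrelevant): continuous, non-increasing, `ψ 0 = 1`, `ψ → 0` at infinity, and strictly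
decreasing on `[0, inf {z | ψ z = 0}]`, the set of all `z ≥ 0` with no zero of `ψ` in `[0, z)`. -/
structure IsGenerator (ψ : ℝ → ℝ) : Prop where
  continuousOn : ContinuousOn ψ (Ici 0)
  antitoneOn : AntitoneOn ψ (Ici 0)
  map_zero : ψ 0 = 1
  tendsto_zero : Tendsto ψ atTop (𝓝 0)
  strictAntiOn : StrictAntiOn ψ {z | 0 ≤ z ∧ ∀ w, 0 ≤ w → w < z → ψ w ≠ 0}

/-- The pseudoinverse `φ` of `ψ` on `(0,1]`. (The value `φ(0) = inf {z ∈ [0,∞] | ψ z = 0}`, which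
may be infinite, is treated separately below.) -/
noncomputable def pseudoInv (ψ : ℝ → ℝ) (t : ℝ) : ℝ := sInf {z | 0 ≤ z ∧ ψ z = t}

open Classical in
/-- The function `ψ(φ(z₁) + ⋯ + φ(z_d))`. If some `z_i` is `0`, the argument of `ψ` is at least
`φ(0) ∈ [0,∞]`, and the value is `0` (with `ψ(∞) = 0`). -/
noncomputable def archimedeanFn (ψ : ℝ → ℝ) {d : ℕ} (z : Fin d → I) : ℝ :=
  if ∃ i, z i = 0 then 0 else ψ (∑ i, pseudoInv ψ (z i))

/-- `C` is a strict `d`-dimensional Archimedean copula with generator `ψ`; strictness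
`φ(0) = ∞` means that `ψ` has no zero. -/
structure IsStrictArchimedean {d : ℕ} (C : (Fin d → I) → ℝ) (ψ : ℝ → ℝ) : Prop where
  isCopula : IsCopula C
  isGenerator : IsGenerator ψ
  strict : ∀ z, 0 ≤ z → ψ z ≠ 0
  eq_archimedeanFn : ∀ z, C z = archimedeanFn ψ z

/-! ## Conditional copulas -/

open Classical in
/-- The conditional distribution function `y ↦ K_C(x, [0,y])`, for `x ∈ (0,1)^l`, of the strict
`(l + m)`-dimensional Archimedean copula `C` with generator `ψ`:
`ψ^(l)(∑ φ(x_i) + ∑ φ(y_j)) / ψ^(l)(∑ φ(x_i))`, which is `0` if some `y_j` is `0`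
(with `φ(0) = ∞` and `ψ^(l)(∞) = 0`). -/
noncomputable def archCondCDF (ψ : ℝ → ℝ) {l m : ℕ} (x : Fin l → I) (y : Fin m → I) : ℝ :=
  if ∃ j, y j = 0 then 0
  else iteratedDeriv l ψ (∑ i, pseudoInv ψ (x i) + ∑ j, pseudoInv ψ (y j)) /
    iteratedDeriv l ψ (∑ i, pseudoInv ψ (x i))

/-- The `j`-th univariate margin `t ↦ F(1, …, 1, t, 1, …, 1)` of a distribution function `F` on
the cube. -/
def margin {m : ℕ} (F : (Fin m → I) → ℝ) (j : Fin m) (t : I) : ℝ :=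
  F (Function.update (fun _ => 1) j t)

/-- The function `u ↦ F(F₁⁻¹(u₁), …, F_m⁻¹(u_m))` attached to a distribution function `F` on the
cube, where `F_j⁻¹(u) = inf {t ∈ I | u ≤ F_j(t)}` is the inverse of the `j`-th margin. -/
noncomputable def sklarCopula {m : ℕ} (F : (Fin m → I) → ℝ) (u : Fin m → I) : ℝ :=
  F fun j => sInf {t : I | (u j : ℝ) ≤ margin F j t}

/-- The conditional copula `C^x`, for `x ∈ (0,1)^l`, of the strict `(l + m)`-dimensional
Archimedean copula `C` with generator `ψ`: the copula of the distribution function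
`y ↦ K_C(x, [0,y])`. -/
noncomputable def condCopula (ψ : ℝ → ℝ) {l m : ℕ} (x : Fin l → I) : (Fin m → I) → ℝ :=
  sklarCopula (archCondCDF ψ x)

/-- `D` is a copula of the distribution function `F` on the cube, in the sense of Sklar's theorem:
`F(y) = D(F₁(y₁), …, F_m(y_m))`. -/
def IsCopulaOf {m : ℕ} (D F : (Fin m → I) → ℝ) : Prop :=
  IsCopula D ∧ ∀ y u : Fin m → I, (∀ j, (u j : ℝ) = margin F j (y j)) → F y = D u

end ArchCopula

namespace ArchCopula

/-- `n`-monotone functions on `(0, ∞)`, through iterated differences. -/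
def IsMultiplyMonotone : ℕ → (ℝ → ℝ) → Prop
  | 0, g => ∀ t, 0 < t → 0 ≤ g t
  | n + 1, g => (∀ t, 0 < t → 0 ≤ g t) ∧
      ∀ h, 0 < h → IsMultiplyMonotone n (fun t => g t - g (t + h))

namespace IsMultiplyMonotone

theorem nonneg {n : ℕ} {g : ℝ → ℝ} (hg : IsMultiplyMonotone n g) {t : ℝ} (ht : 0 < t) :
    0 ≤ g t := by
  cases n with
  | zero => exact hg t ht
  | succ n => exact hg.1 t ht

theorem pred {n : ℕ} {g : ℝ → ℝ} (hg : IsMultiplyMonotone (n + 1) g) :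
    IsMultiplyMonotone n g := by
  induction n generalizing g with
  | zero => exact hg.1
  | succ n ih => exact ⟨hg.1, fun h hh => ih (hg.2 h hh)⟩

theorem mono {n m : ℕ} (hmn : m ≤ n) {g : ℝ → ℝ} (hg : IsMultiplyMonotone n g) :
    IsMultiplyMonotone m g := by
  induction n, hmn using Nat.le_induction with
  | base => exact hg
  | succ n _ ih => exact ih hg.pred

theorem const_mul {n : ℕ} {g : ℝ → ℝ} (hg : IsMultiplyMonotone n g) {c : ℝ} (hc : 0 ≤ c) :
    IsMultiplyMonotone n (fun t => c * g t) := by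
  induction n generalizing g with
  | zero => exact fun t ht => mul_nonneg hc (hg t ht)
  | succ n ih =>
    refine ⟨fun t ht => mul_nonneg hc (hg.1 t ht), fun h hh => ?_⟩
    simpa only [mul_sub] using ih (hg.2 h hh)

theorem of_tendsto {n : ℕ} {u : ℕ → ℝ → ℝ} {g : ℝ → ℝ} (hu : ∀ i, IsMultiplyMonotone n (u i))
    (hlim : ∀ t, 0 < t → Tendsto (fun i => u i t) atTop (𝓝 (g t))) : IsMultiplyMonotone n g := by
  induction n generalizing u g with
  | zero => exact fun t ht => ge_of_tendsto' (hlim t ht) fun i => hu i t ht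
  | succ n ih =>
    refine ⟨fun t ht => ge_of_tendsto' (hlim t ht) fun i => (hu i).1 t ht, fun h hh => ?_⟩
    exact ih (fun i => (hu i).2 h hh) fun t ht => (hlim t ht).sub (hlim (t + h) (by positivity))

theorem antitoneOn {n : ℕ} {g : ℝ → ℝ} (hg : IsMultiplyMonotone (n + 1) g) :
    AntitoneOn g (Ioi 0) := by
  intro a ha b _ hab
  rcases hab.eq_or_lt with rfl | hab
  · exact le_rfl
  · have := (hg.2 (b - a) (sub_pos.2 hab)).nonneg ha
    simp only [add_sub_cancel] at this
    linarith

theorem decrement_le {n : ℕ} {g : ℝ → ℝ} (hg : IsMultiplyMonotone (n + 2) g) {a b h : ℝ}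
    (ha : 0 < a) (hab : a ≤ b) (hh : 0 < h) : g b - g (b + h) ≤ g a - g (a + h) :=
  (hg.2 h hh).antitoneOn ha (ha.trans_le hab) hab

theorem nsmul_decrement_le {n : ℕ} {g : ℝ → ℝ} (hg : IsMultiplyMonotone (n + 2) g) {a b h : ℝ}
    (hh : 0 < h) (N : ℕ) (ha : 0 < a) (hab : a + N * h ≤ b + h) :
    N * (g b - g (b + h)) ≤ g a - g (a + N * h) := by
  induction N with
  | zero => simp
  | succ N ih =>
    push_cast at hab ⊢
    have h1 := ih (by nlinarith)
    have h2 := hg.decrement_le (a := a + N * h) (b := b) (h := h) (by positivity) (by nlinarith) hh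
    rw [show a + (N + 1) * h = a + N * h + h by ring]
    linarith

theorem le_nsmul_decrement {n : ℕ} {g : ℝ → ℝ} (hg : IsMultiplyMonotone (n + 2) g) {b h : ℝ}
    (hh : 0 < h) (N : ℕ) (hb : 0 < b) :
    g b - g (b + N * h) ≤ N * (g b - g (b + h)) := by
  induction N with
  | zero => simp
  | succ N ih =>
    push_cast
    have h2 := hg.decrement_le (a := b) (b := b + N * h) (h := h) hb
      (by have : 0 ≤ N * h := by positivity
          linarith) hh
    rw [show b + (N + 1) * h = b + N * h + h by ring]
    linarith

theorem slope_le {n : ℕ} {g : ℝ → ℝ} (hg : IsMultiplyMonotone (n + 2) g) {a b c : ℝ}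
    (ha : 0 < a) (hab : a < b) (hbc : b < c) :
    (b - a) * (g b - g c) ≤ (c - b) * (g a - g b) := by
  have hb : 0 < b := ha.trans hab
  have key : ∀ h : ℝ, 0 < h → (b - a - h) * (g b - g c) ≤ (c - b + h) * (g a - g b) := by
    intro h hh
    have hN1 : (⌊(b - a) / h⌋₊ : ℝ) * h ≤ b - a := by
      have := Nat.floor_le (a := (b - a) / h) (by have := sub_pos.2 hab; positivity)
      rwa [le_div_iff₀ hh] at this
    have hN1' : b - a - h ≤ (⌊(b - a) / h⌋₊ : ℝ) * h := by
      have := (Nat.lt_floor_add_one ((b - a) / h)).le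
      rw [div_le_iff₀ hh] at this
      linarith
    have hN2 : c - b ≤ (⌈(c - b) / h⌉₊ : ℝ) * h := by
      have := Nat.le_ceil ((c - b) / h)
      rwa [div_le_iff₀ hh] at this
    have hN2' : (⌈(c - b) / h⌉₊ : ℝ) * h ≤ c - b + h := by
      have := (Nat.ceil_lt_add_one (a := (c - b) / h) (by have := sub_pos.2 hbc; positivity)).le
      have := mul_le_mul_of_nonneg_right this hh.le
      rwa [add_mul, div_mul_cancel₀ _ hh.ne', one_mul] at this
    set N1 := ⌊(b - a) / h⌋₊
    set N2 := ⌈(c - b) / h⌉₊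
    have hanti := hg.antitoneOn
    have e1 : N1 * (g b - g (b + h)) ≤ g a - g b := by
      refine (hg.nsmul_decrement_le hh N1 ha (b := b) (by linarith)).trans ?_
      have := hanti (a := a + N1 * h) (b := b) (mem_Ioi.2 (by positivity)) hb (by linarith)
      linarith
    have e2 : g b - g c ≤ N2 * (g b - g (b + h)) := by
      refine le_trans ?_ (hg.le_nsmul_decrement hh N2 hb)
      have := hanti (a := c) (b := b + N2 * h) (hb.trans hbc) (mem_Ioi.2 (by positivity))
        (by linarith)
      linarith
    have hd0 : 0 ≤ g b - g (b + h) := by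
      have := hanti (a := b) (b := b + h) hb (mem_Ioi.2 (by positivity)) (by linarith)
      linarith
    have hbc0 : 0 ≤ g b - g c := by
      have := hanti (a := b) (b := c) hb (hb.trans hbc) hbc.le
      linarith
    have hab0 : 0 ≤ g a - g b := by
      have := hanti (a := a) (b := b) ha hb hab.le
      linarith
    calc (b - a - h) * (g b - g c) ≤ (N1 * h) * (g b - g c) := by gcongr
      _ ≤ (N1 * h) * (N2 * (g b - g (b + h))) := by gcongr
      _ = (N2 * h) * (N1 * (g b - g (b + h))) := by ring
      _ ≤ (N2 * h) * (g a - g b) := by gcongr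
      _ ≤ (c - b + h) * (g a - g b) := by gcongr
  have l1 : Tendsto (fun h : ℝ => (b - a - h) * (g b - g c)) (𝓝[>] 0)
      (𝓝 ((b - a - 0) * (g b - g c))) :=
    (Continuous.tendsto (by fun_prop) 0).mono_left nhdsWithin_le_nhds
  have l2 : Tendsto (fun h : ℝ => (c - b + h) * (g a - g b)) (𝓝[>] 0)
      (𝓝 ((c - b + 0) * (g a - g b))) :=
    (Continuous.tendsto (by fun_prop) 0).mono_left nhdsWithin_le_nhds
  have := le_of_tendsto_of_tendsto l1 l2
    (eventually_nhdsWithin_of_forall fun h hh => key h hh)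
  simpa using this

theorem convexOn {n : ℕ} {g : ℝ → ℝ} (hg : IsMultiplyMonotone (n + 2) g) :
    ConvexOn ℝ (Ioi 0) g := by
  refine convexOn_of_slope_mono_adjacent (convex_Ioi 0) fun {x y z} hx _ hxy hyz => ?_
  rw [div_le_div_iff₀ (sub_pos.2 hxy) (sub_pos.2 hyz)]
  have := hg.slope_le hx hxy hyz
  linarith

end IsMultiplyMonotone

/-- The negative of the right derivative. -/
noncomputable def negRightDeriv (g : ℝ → ℝ) (t : ℝ) : ℝ := -derivWithin g (Ioi t) t

namespace IsMultiplyMonotone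

theorem hasDerivWithinAt {n : ℕ} {g : ℝ → ℝ} (hg : IsMultiplyMonotone (n + 2) g) {t : ℝ}
    (ht : 0 < t) : HasDerivWithinAt g (-negRightDeriv g t) (Ioi t) t := by
  rw [negRightDeriv, neg_neg]
  exact hg.convexOn.hasDerivWithinAt_rightDeriv_of_mem_interior (by simpa using ht)

theorem tendsto_div_negRightDeriv {n : ℕ} {g : ℝ → ℝ} (hg : IsMultiplyMonotone (n + 2) g) {t : ℝ}
    (ht : 0 < t) :
    Tendsto (fun h => h⁻¹ * (g t - g (t + h))) (𝓝[>] 0) (𝓝 (negRightDeriv g t)) := by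
  have h1 := ((hasDerivWithinAt_iff_tendsto_slope' self_notMem_Ioi).1 (hg.hasDerivWithinAt ht)).neg
  have h2 : Tendsto (fun h : ℝ => t + h) (𝓝[>] 0) (𝓝[>] t) := by
    refine tendsto_nhdsWithin_iff.2 ⟨?_, ?_⟩
    · have : Tendsto (fun h : ℝ => t + h) (𝓝 0) (𝓝 (t + 0)) := Continuous.tendsto (by fun_prop) 0
      rw [add_zero] at this
      exact this.mono_left nhdsWithin_le_nhds
    · exact eventually_nhdsWithin_of_forall fun h hh => by simpa using hh
  rw [neg_neg] at h1
  refine (h1.comp h2).congr fun h => ?_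
  simp [slope_def_field, div_eq_inv_mul]
  ring

theorem negRightDeriv_succ {n : ℕ} {g : ℝ → ℝ} (hg : IsMultiplyMonotone (n + 2) g) :
    IsMultiplyMonotone (n + 1) (negRightDeriv g) := by
  refine of_tendsto (u := fun i t => ((i : ℝ) + 1)⁻¹⁻¹ * (g t - g (t + ((i : ℝ) + 1)⁻¹)))
    (fun i => ?_) fun t ht => ?_
  · exact (hg.2 _ (by positivity)).const_mul (by positivity)
  · refine (hg.tendsto_div_negRightDeriv ht).comp (tendsto_nhdsWithin_iff.2 ⟨?_, ?_⟩)
    · exact (tendsto_natCast_atTop_atTop.atTop_add tendsto_const_nhds).inv_tendsto_atTop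
    · exact Eventually.of_forall fun i => mem_Ioi.2 (by positivity)

theorem negRightDeriv_mul_le {n : ℕ} {g : ℝ → ℝ} (hg : IsMultiplyMonotone (n + 2) g) {a b : ℝ}
    (ha : 0 < a) (hab : a < b) : negRightDeriv g b * (b - a) ≤ g a - g b := by
  rw [← le_div_iff₀ (sub_pos.2 hab)]
  refine le_of_tendsto (hg.tendsto_div_negRightDeriv (ha.trans hab))
    (eventually_nhdsWithin_of_forall fun h hh => ?_)
  have hh : 0 < h := hh
  rw [inv_mul_le_iff₀ hh, ← mul_div_assoc, le_div_iff₀ (sub_pos.2 hab)]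
  have := hg.slope_le (c := b + h) ha hab (by linarith)
  rw [add_sub_cancel_left] at this
  linarith

theorem le_negRightDeriv_mul {n : ℕ} {g : ℝ → ℝ} (hg : IsMultiplyMonotone (n + 2) g) {a b : ℝ}
    (ha : 0 < a) (hab : a < b) : g a - g b ≤ negRightDeriv g a * (b - a) := by
  rw [← div_le_iff₀ (sub_pos.2 hab)]
  refine ge_of_tendsto (hg.tendsto_div_negRightDeriv ha) ?_
  filter_upwards [Ioo_mem_nhdsGT (sub_pos.2 hab)] with h hh
  have hh0 : 0 < h := hh.1
  rw [le_inv_mul_iff₀ hh0, ← mul_div_assoc, div_le_iff₀ (sub_pos.2 hab)]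
  have := hg.slope_le (a := a) (b := a + h) (c := b) ha (by linarith) (by linarith [hh.2])
  nlinarith

theorem continuousOn {n : ℕ} {g : ℝ → ℝ} (hg : IsMultiplyMonotone (n + 2) g) :
    ContinuousOn g (Ioi 0) :=
  hg.convexOn.continuousOn isOpen_Ioi

theorem hasDerivAt {n : ℕ} {g : ℝ → ℝ} (hg : IsMultiplyMonotone (n + 3) g) {t : ℝ} (ht : 0 < t) :
    HasDerivAt g (-negRightDeriv g t) t := by
  have hcont : ContinuousAt (negRightDeriv g) t :=
    hg.negRightDeriv_succ.continuousOn.continuousAt (Ioi_mem_nhds ht)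
  rw [hasDerivAt_iff_tendsto_slope]
  have hc : Tendsto (negRightDeriv g) (𝓝[≠] t) (𝓝 (negRightDeriv g t)) :=
    hcont.mono_left nhdsWithin_le_nhds
  have key : ∀ᶠ s in 𝓝[≠] t, min (-negRightDeriv g s) (-negRightDeriv g t) ≤ slope g t s ∧
      slope g t s ≤ max (-negRightDeriv g s) (-negRightDeriv g t) := by
    filter_upwards [nhdsWithin_le_nhds (Ioi_mem_nhds ht), self_mem_nhdsWithin] with s hs hst
    rcases lt_or_gt_of_ne hst with h | h
    · rw [slope_comm, slope_def_field]
      have h1 := hg.negRightDeriv_mul_le hs h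
      have h2 := hg.le_negRightDeriv_mul hs h
      have h3 := sub_pos.2 h
      exact ⟨min_le_of_left_le ((le_div_iff₀ h3).2 (by linarith)),
        le_max_of_le_right ((div_le_iff₀ h3).2 (by linarith))⟩
    · rw [slope_def_field]
      have h1 := hg.negRightDeriv_mul_le ht h
      have h2 := hg.le_negRightDeriv_mul ht h
      have h3 := sub_pos.2 h
      exact ⟨min_le_of_right_le ((le_div_iff₀ h3).2 (by linarith)),
        le_max_of_le_left ((div_le_iff₀ h3).2 (by linarith))⟩
  have e1 := hc.neg.min (tendsto_const_nhds (x := -negRightDeriv g t))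
  have e2 := hc.neg.max (tendsto_const_nhds (x := -negRightDeriv g t))
  rw [min_self] at e1
  rw [max_self] at e2
  exact tendsto_of_tendsto_of_tendsto_of_le_of_le' e1 e2 (key.mono fun s hs => hs.1)
    (key.mono fun s hs => hs.2)

theorem tendsto_negRightDeriv_atTop {n : ℕ} {g : ℝ → ℝ} (hg : IsMultiplyMonotone (n + 2) g)
    (h0 : Tendsto g atTop (𝓝 0)) : Tendsto (negRightDeriv g) atTop (𝓝 0) := by
  have h1 : Tendsto (fun t : ℝ => g (t - 1)) atTop (𝓝 0) :=
    h0.comp (tendsto_atTop_add_const_right _ (-1) tendsto_id)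
  refine tendsto_of_tendsto_of_tendsto_of_le_of_le' tendsto_const_nhds (by simpa using h1.sub h0)
    ?_ ?_
  · filter_upwards [eventually_gt_atTop 0] with t ht using hg.negRightDeriv_succ.nonneg ht
  · filter_upwards [eventually_gt_atTop 1] with t ht
    have := hg.negRightDeriv_mul_le (a := t - 1) (b := t) (by linarith) (by linarith)
    simpa using this

theorem setLIntegral_negRightDeriv {n : ℕ} {g : ℝ → ℝ} (hg : IsMultiplyMonotone (n + 2) g)
    (h0 : Tendsto g atTop (𝓝 0)) {c : ℝ} (hc : 0 < c) :
    ∫⁻ t in Ioi c, ENNReal.ofReal (negRightDeriv g t) = ENNReal.ofReal (g c) := by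
  have hint : ∀ b, c ≤ b → IntegrableOn (negRightDeriv g) (Ioc c b) := fun b hb => by
    refine (AntitoneOn.integrableOn_isCompact isCompact_Icc
      (hg.negRightDeriv_succ.antitoneOn.mono fun x hx => hc.trans_le hx.1)).mono_set
      Ioc_subset_Icc_self
  have hval : ∀ b, c ≤ b → ∫⁻ t in Ioc c b, ENNReal.ofReal (negRightDeriv g t)
      = ENNReal.ofReal (g c - g b) := by
    intro b hb
    rw [← ofReal_integral_eq_lintegral_ofReal (hint b hb)
      ((ae_restrict_iff' measurableSet_Ioc).2 (Eventually.of_forall fun t ht =>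
        hg.negRightDeriv_succ.nonneg (hc.trans ht.1)))]
    congr 1
    rw [← intervalIntegral.integral_of_le hb]
    have h2 : IntervalIntegrable (fun t => -negRightDeriv g t) volume c b :=
      ((intervalIntegrable_iff_integrableOn_Ioc_of_le hb).2 (hint b hb)).neg
    have := intervalIntegral.integral_eq_sub_of_hasDeriv_right_of_le hb
      (hg.continuousOn.mono fun x hx => hc.trans_le hx.1)
      (fun x hx => hg.hasDerivWithinAt (hc.trans hx.1)) h2
    rw [intervalIntegral.integral_neg] at this
    linarith
  have hU : ⋃ i : ℕ, Ioc c (c + i) = Ioi c := by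
    ext t
    simp only [mem_iUnion, mem_Ioc, mem_Ioi]
    refine ⟨fun ⟨_, h⟩ => h.1, fun h => ?_⟩
    obtain ⟨i, hi⟩ := exists_nat_ge (t - c)
    exact ⟨i, h, by linarith⟩
  have hmono : Monotone fun i : ℕ => Ioc c (c + i) := fun i j hij =>
    Ioc_subset_Ioc_right (by gcongr)
  have hlim1 : Tendsto (fun i : ℕ => ∫⁻ t in Ioc c (c + i), ENNReal.ofReal (negRightDeriv g t)) atTop
      (𝓝 (∫⁻ t in Ioi c, ENNReal.ofReal (negRightDeriv g t))) := by
    rw [← hU, setLIntegral_iUnion_of_directed _ hmono.directed_le]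
    exact tendsto_atTop_iSup fun i j hij => lintegral_mono_set (hmono hij)
  have hlim2 : Tendsto (fun i : ℕ => ENNReal.ofReal (g c - g (c + i))) atTop
      (𝓝 (ENNReal.ofReal (g c))) := by
    have : Tendsto (fun i : ℕ => g (c + i)) atTop (𝓝 0) :=
      h0.comp (tendsto_atTop_add_const_left _ _ tendsto_natCast_atTop_atTop)
    simpa using ENNReal.tendsto_ofReal (this.const_sub (g c))
  exact tendsto_nhds_unique hlim1 (hlim2.congr fun i => (hval _ (by simp)).symm)

theorem tendsto_negRightDeriv_comp {n : ℕ} {u : ℕ → ℝ → ℝ} {g : ℝ → ℝ}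
    (hu : ∀ i, IsMultiplyMonotone (n + 2) (u i)) (hg : IsMultiplyMonotone (n + 2) g)
    (hlim : ∀ t, 0 < t → Tendsto (fun i => u i t) atTop (𝓝 (g t)))
    {s : ℕ → ℝ} {t : ℝ} (ht : 0 < t) (hs : Tendsto s atTop (𝓝 t))
    (hcont : ContinuousAt (negRightDeriv g) t) :
    Tendsto (fun i => negRightDeriv (u i) (s i)) atTop (𝓝 (negRightDeriv g t)) := by
  have hquot : ∀ a b : ℝ, 0 < a → 0 < b →
      Tendsto (fun i => (u i a - u i b) / (b - a)) atTop (𝓝 ((g a - g b) / (b - a))) :=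
    fun a b ha hb => ((hlim a ha).sub (hlim b hb)).div_const _
  refine tendsto_order.2 ⟨fun y hy => ?_, fun y hy => ?_⟩
  · obtain ⟨c, hc, hcy⟩ := mem_nhdsGE_iff_exists_Ico_subset.1
      (nhdsWithin_le_nhds (hcont.eventually_const_lt hy))
    rw [mem_Ioi] at hc
    obtain ⟨b, htb, hbc⟩ := exists_between hc
    obtain ⟨a, hta, hab⟩ := exists_between htb
    have ha : 0 < a := ht.trans hta
    have hb : y < negRightDeriv g b := hcy ⟨htb.le, hbc⟩
    have h1 : negRightDeriv g b ≤ (g a - g b) / (b - a) :=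
      (le_div_iff₀ (sub_pos.2 hab)).2 (hg.negRightDeriv_mul_le ha hab)
    filter_upwards [(hquot a b ha (ha.trans hab)).eventually_const_lt (hb.trans_le h1),
      hs.eventually_lt_const hta, hs.eventually_const_lt ht] with i hi hsi hsi0
    refine hi.trans_le (((div_le_iff₀ (sub_pos.2 hab)).2 ((hu i).le_negRightDeriv_mul ha hab)).trans
      ((hu i).negRightDeriv_succ.antitoneOn hsi0 ha hsi.le))
  · obtain ⟨c, hc, hcy⟩ := mem_nhdsLE_iff_exists_Ioc_subset.1
      (nhdsWithin_le_nhds (hcont.eventually_lt_const hy))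
    rw [mem_Iio] at hc
    obtain ⟨a, hca, hat⟩ := exists_between (max_lt hc ht)
    obtain ⟨b, hab, hbt⟩ := exists_between hat
    have ha : 0 < a := (le_max_right _ _).trans_lt hca
    have hb : negRightDeriv g a < y := hcy ⟨(le_max_left _ _).trans_lt hca, hat.le⟩
    have h1 : (g a - g b) / (b - a) ≤ negRightDeriv g a :=
      (div_le_iff₀ (sub_pos.2 hab)).2 (hg.le_negRightDeriv_mul ha hab)
    filter_upwards [(hquot a b ha (ha.trans hab)).eventually_lt_const (h1.trans_lt hb),
      hs.eventually_const_lt hbt, hs.eventually_const_lt ht] with i hi hsi hsi0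
    exact ((hu i).negRightDeriv_succ.antitoneOn (ha.trans hab) hsi0 hsi.le).trans_lt
      (((le_div_iff₀ (sub_pos.2 hab)).2 ((hu i).negRightDeriv_mul_le ha hab)).trans_lt hi)

end IsMultiplyMonotone

theorem measurable_negRightDeriv (g : ℝ → ℝ) : Measurable (negRightDeriv g) :=
  (measurable_derivWithin_Ioi g).neg

/-- The iterated negative right derivative. It is `(-1) ^ j` times the `j`-th derivative of a
sufficiently monotone function. -/
noncomputable def altDeriv (g : ℝ → ℝ) : ℕ → ℝ → ℝ
  | 0 => g
  | j + 1 => negRightDeriv (altDeriv g j)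

namespace IsMultiplyMonotone

theorem altDeriv {n : ℕ} {g : ℝ → ℝ} {j : ℕ} (hg : IsMultiplyMonotone (n + 1 + j) g) :
    IsMultiplyMonotone (n + 1) (altDeriv g j) := by
  induction j generalizing n with
  | zero => exact hg
  | succ j ih =>
    refine negRightDeriv_succ (n := n) (ih (n := n + 1) ?_)
    rwa [show n + 1 + 1 + j = n + 1 + (j + 1) by ring]

theorem tendsto_altDeriv_atTop {g : ℝ → ℝ} {j : ℕ} (hg : IsMultiplyMonotone (1 + j) g)
    (h0 : Tendsto g atTop (𝓝 0)) : Tendsto (ArchCopula.altDeriv g j) atTop (𝓝 0) := by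
  induction j with
  | zero => exact h0
  | succ j ih =>
    have h1 : IsMultiplyMonotone (0 + 2) (ArchCopula.altDeriv g j) :=
      altDeriv (n := 1) (hg.mono (by omega))
    exact h1.tendsto_negRightDeriv_atTop (ih (hg.mono (by omega)))

theorem altDeriv_pos {g : ℝ → ℝ} {j : ℕ} (hg : IsMultiplyMonotone (1 + j) g)
    (h0 : Tendsto g atTop (𝓝 0)) (hpos : ∀ t, 0 < t → 0 < g t) {t : ℝ} (ht : 0 < t) :
    0 < ArchCopula.altDeriv g j t := by
  induction j generalizing t with
  | zero => exact hpos t ht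
  | succ j ih =>
    have h1 : IsMultiplyMonotone (0 + 2) (ArchCopula.altDeriv g j) :=
      altDeriv (n := 1) (hg.mono (by omega))
    have h2 := h1.setLIntegral_negRightDeriv ((hg.mono (by omega)).tendsto_altDeriv_atTop h0) ht
    refine lt_of_le_of_ne (h1.negRightDeriv_succ.nonneg ht) fun h => ?_
    have h3 : ∫⁻ s in Ioi t, ENNReal.ofReal (negRightDeriv (ArchCopula.altDeriv g j) s) = 0 := by
      rw [setLIntegral_congr_fun (g := fun _ => 0) measurableSet_Ioi, lintegral_zero]
      intro s hs
      have := h1.negRightDeriv_succ.antitoneOn ht (ht.trans hs) (le_of_lt hs)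
      rw [← show 0 = negRightDeriv (ArchCopula.altDeriv g j) t from h] at this
      exact ENNReal.ofReal_eq_zero.2 this
    rw [h3] at h2
    exact absurd (ENNReal.ofReal_eq_zero.1 h2.symm) (not_le.2 (ih (hg.mono (by omega)) ht))

theorem altDeriv_lt {g : ℝ → ℝ} {j : ℕ} (hg : IsMultiplyMonotone (2 + j) g)
    (h0 : Tendsto g atTop (𝓝 0)) (hpos : ∀ t, 0 < t → 0 < g t) {a b : ℝ} (ha : 0 < a)
    (hab : a < b) : ArchCopula.altDeriv g j b < ArchCopula.altDeriv g j a := by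
  have h1 : IsMultiplyMonotone (0 + 2) (ArchCopula.altDeriv g j) := altDeriv (n := 1) hg
  have h2 := h1.negRightDeriv_mul_le ha hab
  have h3 : 0 < ArchCopula.altDeriv g (j + 1) b :=
    altDeriv_pos (hg.mono (by omega)) h0 hpos (ha.trans hab)
  have := mul_pos h3 (sub_pos.2 hab)
  rw [ArchCopula.altDeriv] at this
  linarith

theorem iteratedDeriv_eq {g : ℝ → ℝ} {j : ℕ} (hg : IsMultiplyMonotone (2 + j) g) {t : ℝ}
    (ht : 0 < t) : iteratedDeriv j g t = (-1) ^ j * ArchCopula.altDeriv g j t := by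
  induction j generalizing t with
  | zero => simp [ArchCopula.altDeriv]
  | succ j ih =>
    have h1 : IsMultiplyMonotone (0 + 3) (ArchCopula.altDeriv g j) :=
      altDeriv (n := 2) (hg.mono (by omega))
    have h2 : iteratedDeriv j g =ᶠ[𝓝 t] fun t => (-1) ^ j * ArchCopula.altDeriv g j t := by
      filter_upwards [Ioi_mem_nhds ht] with s hs using ih (hg.mono (by omega)) hs
    rw [iteratedDeriv_succ, h2.deriv_eq, ((h1.hasDerivAt ht).const_mul _).deriv,
      ArchCopula.altDeriv, pow_succ]
    ring

theorem tendsto_altDeriv {u : ℕ → ℝ → ℝ} {g : ℝ → ℝ} {j : ℕ}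
    (hu : ∀ i, IsMultiplyMonotone (2 + j) (u i)) (hg : IsMultiplyMonotone (2 + j) g)
    (hlim : ∀ t, 0 < t → Tendsto (fun i => u i t) atTop (𝓝 (g t))) {t : ℝ} (ht : 0 < t) :
    Tendsto (fun i => ArchCopula.altDeriv (u i) j t) atTop (𝓝 (ArchCopula.altDeriv g j t)) := by
  induction j generalizing t with
  | zero => exact hlim t ht
  | succ j ih =>
    have h1 : ∀ {v}, IsMultiplyMonotone (2 + (j + 1)) v →
        IsMultiplyMonotone (1 + 2) (ArchCopula.altDeriv v j) := fun h =>
      altDeriv (n := 2) (h.mono (by omega))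
    exact tendsto_negRightDeriv_comp (fun i => h1 (hu i)) (h1 hg)
      (fun s hs => ih (fun i => (hu i).mono (by omega)) (hg.mono (by omega)) hs) ht
      tendsto_const_nhds
      ((h1 hg).negRightDeriv_succ.continuousOn.continuousAt (Ioi_mem_nhds ht))

theorem tendsto_altDeriv_succ_comp {u : ℕ → ℝ → ℝ} {g : ℝ → ℝ} {j : ℕ}
    (hu : ∀ i, IsMultiplyMonotone (2 + j) (u i)) (hg : IsMultiplyMonotone (2 + j) g)
    (hlim : ∀ t, 0 < t → Tendsto (fun i => u i t) atTop (𝓝 (g t)))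
    {s : ℕ → ℝ} {t : ℝ} (ht : 0 < t) (hs : Tendsto s atTop (𝓝 t))
    (hcont : ContinuousAt (ArchCopula.altDeriv g (j + 1)) t) :
    Tendsto (fun i => ArchCopula.altDeriv (u i) (j + 1) (s i)) atTop
      (𝓝 (ArchCopula.altDeriv g (j + 1) t)) :=
  tendsto_negRightDeriv_comp (n := 0) (fun i => altDeriv (n := 1) ((hu i).mono (by omega)))
    (altDeriv (n := 1) (hg.mono (by omega)))
    (fun _ h => tendsto_altDeriv hu hg hlim h) ht hs hcont

theorem setLIntegral_altDeriv {g : ℝ → ℝ} {j : ℕ} (hg : IsMultiplyMonotone (2 + j) g)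
    (h0 : Tendsto g atTop (𝓝 0)) {c : ℝ} (hc : 0 < c) :
    ∫⁻ t in Ioi c, ENNReal.ofReal (ArchCopula.altDeriv g (j + 1) t) =
      ENNReal.ofReal (ArchCopula.altDeriv g j c) :=
  setLIntegral_negRightDeriv (n := 0) (altDeriv (n := 1) hg)
    ((hg.mono (by omega)).tendsto_altDeriv_atTop h0) hc

end IsMultiplyMonotone

theorem measurable_altDeriv (g : ℝ → ℝ) {j : ℕ} (hj : 1 ≤ j) : Measurable (altDeriv g j) := by
  obtain ⟨j, rfl⟩ := Nat.exists_eq_add_of_le' hj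
  exact measurable_negRightDeriv _

theorem isMultiplyMonotone_of_measureReal {Ω : Type*} [MeasurableSpace Ω] {n : ℕ} (ν : Measure Ω)
    [IsFiniteMeasure ν] (A : Fin (n + 1) → ℝ → Set Ω) (hA : ∀ i t, MeasurableSet (A i t))
    (hanti : ∀ i s t, 0 ≤ s → s ≤ t → A i t ⊆ A i s) (g : ℝ → ℝ)
    (hg : ∀ a : Fin (n + 1) → ℝ, (∀ i, 0 ≤ a i) → ν.real (⋂ i, A i (a i)) = g (∑ i, a i)) :
    IsMultiplyMonotone (n + 1) g := by
  induction n generalizing ν g with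
  | zero =>
    have h1 : ∀ t, 0 ≤ t → g t = ν.real (A 0 t) := fun t ht => by
      have h2 := hg (fun _ => t) fun _ => ht
      rw [show (⋂ i, A i t) = A 0 t by ext ω; simp [Fin.forall_fin_one]] at h2
      simpa using h2.symm
    refine ⟨fun t ht => ?_, fun h hh t ht => ?_⟩
    · rw [h1 t ht.le]
      exact measureReal_nonneg
    · change 0 ≤ g t - g (t + h)
      rw [h1 t ht.le, h1 (t + h) (by linarith), sub_nonneg]
      exact measureReal_mono (hanti 0 t (t + h) ht.le (by linarith))
  | succ n ih =>
    refine ⟨fun t ht => ?_, fun h hh => ?_⟩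
    · have h1 := hg (Fin.cons t 0) (fun i => by
        refine Fin.cases ?_ (fun j => ?_) i <;> simp [ht.le])
      rw [Fin.sum_univ_succ] at h1
      simp only [Fin.cons_zero, Fin.cons_succ, Pi.zero_apply, Finset.sum_const_zero,
        add_zero] at h1
      rw [← h1]
      exact measureReal_nonneg
    · refine ih (ν.restrict (A 0 0 \ A 0 h)) (fun i => A i.succ) (fun i => hA i.succ)
        (fun i => hanti i.succ) _ fun a ha => ?_
      have hmeas : MeasurableSet (⋂ i, A i.succ (a i)) := .iInter fun i => hA _ _
      have key : ∀ t, 0 ≤ t → ν.real ((⋂ i, A i.succ (a i)) ∩ A 0 t) = g (∑ i, a i + t) := by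
        intro t ht
        have h1 := hg (Fin.cons t a) (fun i => by
          refine Fin.cases ?_ (fun j => ?_) i <;> simp [ht, ha])
        rw [Fin.sum_univ_succ] at h1
        simp only [Fin.cons_zero, Fin.cons_succ] at h1
        rw [add_comm (∑ i, a i) t, ← h1]
        congr 1
        ext ω
        simp only [mem_inter_iff, mem_iInter, Fin.forall_fin_succ, Fin.cons_zero, Fin.cons_succ]
        tauto
      rw [measureReal_restrict_apply hmeas, show (⋂ i, A i.succ (a i)) ∩ (A 0 0 \ A 0 h) =
          ((⋂ i, A i.succ (a i)) ∩ A 0 0) \ ((⋂ i, A i.succ (a i)) ∩ A 0 h) by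
            ext; simp only [mem_inter_iff, Set.mem_sdiff]; tauto,
        measureReal_sdiff (inter_subset_inter_right _ (hanti 0 0 h le_rfl hh.le))
          (hmeas.inter (hA _ _)), key 0 le_rfl, key h hh.le, add_zero]

/-! ### Strict generators -/

/-- Generators of strict Archimedean copulas. -/
structure IsStrictGenerator (ψ : ℝ → ℝ) : Prop extends IsGenerator ψ where
  strict : ∀ z, 0 ≤ z → ψ z ≠ 0

theorem IsStrictArchimedean.isStrictGenerator {d : ℕ} {C : (Fin d → I) → ℝ} {ψ : ℝ → ℝ}
    (hC : IsStrictArchimedean C ψ) : IsStrictGenerator ψ :=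
  ⟨hC.isGenerator, hC.strict⟩

/-- The point of `I` with coordinate `ψ z`, for `z ≥ 0`. -/
noncomputable def genUnit (ψ : ℝ → ℝ) (z : ℝ) : I := projIcc 0 1 zero_le_one (ψ (max z 0))

theorem pseudoInv_nonneg (ψ : ℝ → ℝ) (t : ℝ) : 0 ≤ pseudoInv ψ t :=
  Real.sInf_nonneg fun _ h => h.1

namespace IsStrictGenerator

variable {ψ : ℝ → ℝ}

theorem strictAnti (h : IsStrictGenerator ψ) : StrictAntiOn ψ (Ici 0) :=
  h.strictAntiOn.mono fun _ hz => ⟨hz, fun w hw _ => h.strict w hw⟩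

theorem pos (h : IsStrictGenerator ψ) {z : ℝ} (hz : 0 ≤ z) : 0 < ψ z := by
  refine lt_of_le_of_ne (le_of_tendsto h.tendsto_zero ?_) (h.strict z hz).symm
  filter_upwards [eventually_ge_atTop z] with w hw
  exact h.antitoneOn hz (hz.trans hw) hw

theorem le_one (h : IsStrictGenerator ψ) {z : ℝ} (hz : 0 ≤ z) : ψ z ≤ 1 := by
  rw [← h.map_zero]
  exact h.antitoneOn self_mem_Ici hz hz

theorem pseudoInv_apply (h : IsStrictGenerator ψ) {z : ℝ} (hz : 0 ≤ z) :
    pseudoInv ψ (ψ z) = z := by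
  have : {w | 0 ≤ w ∧ ψ w = ψ z} = {z} := by
    ext w
    exact ⟨fun hw => h.strictAnti.injOn hw.1 hz hw.2, fun hw => by
      rw [mem_singleton_iff.1 hw]; exact ⟨hz, rfl⟩⟩
  rw [pseudoInv, this, csInf_singleton]

theorem exists_apply_eq (h : IsStrictGenerator ψ) {t : ℝ} (ht : 0 < t) (ht1 : t ≤ 1) :
    ∃ z, 0 ≤ z ∧ ψ z = t := by
  obtain ⟨b, hb, hb0⟩ := ((h.tendsto_zero.eventually_lt_const ht).and (eventually_ge_atTop 0)).exists
  obtain ⟨z, hz, rfl⟩ := intermediate_value_Icc' hb0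
    (h.continuousOn.mono Icc_subset_Ici_self) ⟨hb.le, by rwa [h.map_zero]⟩
  exact ⟨z, hz.1, rfl⟩

theorem apply_pseudoInv (h : IsStrictGenerator ψ) {t : ℝ} (ht : 0 < t) (ht1 : t ≤ 1) :
    ψ (pseudoInv ψ t) = t := by
  obtain ⟨z, hz, rfl⟩ := h.exists_apply_eq ht ht1
  rw [h.pseudoInv_apply hz]

theorem coe_genUnit (h : IsStrictGenerator ψ) {z : ℝ} (hz : 0 ≤ z) : (genUnit ψ z : ℝ) = ψ z := by
  rw [genUnit, max_eq_left hz, projIcc_of_mem zero_le_one ⟨(h.pos hz).le, h.le_one hz⟩]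

theorem continuous_genUnit (h : IsStrictGenerator ψ) : Continuous (genUnit ψ) := by
  refine continuous_projIcc.comp (h.continuousOn.comp_continuous (f := fun z : ℝ => max z 0)
    (by fun_prop) fun z => ?_)
  exact mem_Ici.2 (le_max_right _ _)

theorem genUnit_pos (h : IsStrictGenerator ψ) (z : ℝ) : 0 < genUnit ψ z := by
  have h1 : genUnit ψ z = genUnit ψ (max z 0) := by simp [genUnit]
  rw [h1, ← Subtype.coe_lt_coe, h.coe_genUnit (le_max_right _ _)]
  exact h.pos (le_max_right _ _)

theorem genUnit_zero (h : IsStrictGenerator ψ) : genUnit ψ 0 = 1 := by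
  ext
  rw [h.coe_genUnit le_rfl, h.map_zero, Icc.coe_one]

theorem pseudoInv_genUnit (h : IsStrictGenerator ψ) {z : ℝ} (hz : 0 ≤ z) :
    pseudoInv ψ (genUnit ψ z) = z := by
  rw [h.coe_genUnit hz, h.pseudoInv_apply hz]

theorem genUnit_pseudoInv (h : IsStrictGenerator ψ) {u : I} (hu : u ≠ 0) :
    genUnit ψ (pseudoInv ψ u) = u := by
  ext
  rw [h.coe_genUnit (pseudoInv_nonneg _ _),
    h.apply_pseudoInv (unitInterval.pos_iff_ne_zero.2 hu) u.2.2]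

theorem pseudoInv_one (h : IsStrictGenerator ψ) : pseudoInv ψ 1 = 0 := by
  rw [← h.map_zero, h.pseudoInv_apply le_rfl]

theorem antitone_genUnit (h : IsStrictGenerator ψ) : Antitone (genUnit ψ) := fun _ _ hab =>
  monotone_projIcc _ (h.antitoneOn (mem_Ici.2 (le_max_right _ _)) (mem_Ici.2 (le_max_right _ _)) (max_le_max_right 0 hab))

theorem genUnit_le_genUnit (h : IsStrictGenerator ψ) {a b : ℝ} (ha : 0 ≤ a) (hb : 0 ≤ b) :
    genUnit ψ a ≤ genUnit ψ b ↔ b ≤ a := by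
  rw [← Subtype.coe_le_coe, h.coe_genUnit ha, h.coe_genUnit hb]
  exact h.strictAnti.le_iff_ge ha hb

theorem genUnit_le_iff (h : IsStrictGenerator ψ) {a : ℝ} (ha : 0 ≤ a) {u : I} (hu : u ≠ 0) :
    genUnit ψ a ≤ u ↔ pseudoInv ψ u ≤ a := by
  rw [← h.genUnit_le_genUnit ha (pseudoInv_nonneg _ _), h.genUnit_pseudoInv hu]

theorem le_genUnit_iff (h : IsStrictGenerator ψ) {a : ℝ} (ha : 0 ≤ a) {u : I} (hu : u ≠ 0) :
    u ≤ genUnit ψ a ↔ a ≤ pseudoInv ψ u := by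
  rw [← h.genUnit_le_genUnit (pseudoInv_nonneg _ _) ha, h.genUnit_pseudoInv hu]

theorem pseudoInv_pos (h : IsStrictGenerator ψ) {u : I} (hu : u ≠ 0) (hu1 : u ≠ 1) :
    0 < pseudoInv ψ u := by
  refine lt_of_le_of_ne (pseudoInv_nonneg _ _) fun h0 => hu1 ?_
  rw [← h.genUnit_pseudoInv hu, ← h0, h.genUnit_zero]

theorem measurable_pseudoInv (h : IsStrictGenerator ψ) :
    Measurable fun u : I => pseudoInv ψ u := by
  refine measurable_of_Ici fun a => ?_
  rcases le_or_gt a 0 with ha | ha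
  · convert MeasurableSet.univ
    exact eq_univ_of_forall fun u => ha.trans (pseudoInv_nonneg _ _)
  · have : (fun u : I => pseudoInv ψ u) ⁻¹' Ici a \ {0} = Iic (genUnit ψ a) \ {0} := by
      ext u
      simp only [Set.mem_sdiff, mem_preimage, mem_Ici, mem_Iic, mem_singleton_iff]
      exact and_congr_left fun hu => (h.le_genUnit_iff ha.le hu).symm
    have h2 : (fun u : I => pseudoInv ψ u) ⁻¹' Ici a =
        (Iic (genUnit ψ a) \ {0}) ∪ ((fun u : I => pseudoInv ψ u) ⁻¹' Ici a ∩ {0}) := by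
      rw [← this, Set.sdiff_union_inter]
    rw [h2]
    refine (measurableSet_Iic.diff (measurableSet_singleton _)).union ?_
    exact ((Set.finite_singleton (0 : I)).subset inter_subset_right).measurableSet

end IsStrictGenerator

theorem archimedeanFn_genUnit {ψ : ℝ → ℝ} (h : IsStrictGenerator ψ) {d : ℕ} {a : Fin d → ℝ}
    (ha : ∀ i, 0 ≤ a i) : archimedeanFn ψ (fun i => genUnit ψ (a i)) = ψ (∑ i, a i) := by
  rw [archimedeanFn, if_neg (by
    rintro ⟨i, hi⟩
    exact (h.genUnit_pos (a i)).ne' hi)]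
  simp only [fun i => h.pseudoInv_genUnit (ha i)]

theorem IsStrictArchimedean.isMultiplyMonotone {d : ℕ} {C : (Fin d → I) → ℝ} {ψ : ℝ → ℝ}
    (hC : IsStrictArchimedean C ψ) (hd : 1 ≤ d) : IsMultiplyMonotone d ψ := by
  obtain ⟨n, rfl⟩ := Nat.exists_eq_add_of_le' hd
  refine isMultiplyMonotone_of_measureReal (copulaMeasure C)
    (fun i t => {u | u i ≤ genUnit ψ t}) (fun i t => ?_) (fun i s t _ hst u hu => ?_) ψ fun a ha => ?_
  · exact measurableSet_le (measurable_pi_apply i) measurable_const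
  · exact le_trans hu (hC.isStrictGenerator.antitone_genUnit hst)
  · rw [← archimedeanFn_genUnit hC.isStrictGenerator ha, ← hC.eq_archimedeanFn,
      ← hC.isCopula.copulaMeasure_Iic]
    congr 1
    ext u
    simp [Pi.le_def]

/-! ### Measures on cubes -/

theorem measurableSpace_pi_eq_generateFrom_Iic (d : ℕ) :
    (MeasurableSpace.pi : MeasurableSpace (Fin d → I)) = .generateFrom (range Iic) := by
  refine le_antisymm ?_ (MeasurableSpace.generateFrom_le ?_)
  · refine iSup_le fun i => ?_
    rw [BorelSpace.measurable_eq (α := I), borel_eq_generateFrom_Iic,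
      MeasurableSpace.comap_generateFrom]
    refine MeasurableSpace.generateFrom_mono ?_
    rintro _ ⟨_, ⟨t, rfl⟩, rfl⟩
    refine ⟨Function.update 1 i t, ?_⟩
    ext u
    simp only [mem_Iic, Pi.le_def, mem_preimage]
    refine ⟨fun h => by simpa using h i, fun h j => ?_⟩
    rcases eq_or_ne j i with rfl | hj
    · simpa using h
    · simpa [hj] using unitInterval.le_one'
  · rintro _ ⟨u, rfl⟩
    exact measurableSet_Iic

theorem measurableSpace_prod_eq_generateFrom_Iic (l m : ℕ) :
    (Prod.instMeasurableSpace : MeasurableSpace ((Fin l → I) × (Fin m → I))) =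
      .generateFrom (range Iic) := by
  refine le_antisymm (sup_le ?_ ?_) (MeasurableSpace.generateFrom_le ?_)
  · rw [measurableSpace_pi_eq_generateFrom_Iic, MeasurableSpace.comap_generateFrom]
    refine MeasurableSpace.generateFrom_mono ?_
    rintro _ ⟨_, ⟨u, rfl⟩, rfl⟩
    refine ⟨(u, 1), ?_⟩
    ext p
    simp [Prod.le_def, Pi.le_def, unitInterval.le_one']
  · rw [measurableSpace_pi_eq_generateFrom_Iic m, MeasurableSpace.comap_generateFrom]
    refine MeasurableSpace.generateFrom_mono ?_
    rintro _ ⟨_, ⟨u, rfl⟩, rfl⟩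
    refine ⟨(1, u), ?_⟩
    ext p
    simp [Prod.le_def, Pi.le_def, unitInterval.le_one']
  · rintro _ ⟨⟨u, v⟩, rfl⟩
    rw [← Iic_prod_Iic]
    exact measurableSet_Iic.prod measurableSet_Iic

theorem isPiSystem_range_Iic (α : Type*) [SemilatticeInf α] :
    IsPiSystem (range (Iic : α → Set α)) := by
  rintro _ ⟨a, rfl⟩ _ ⟨b, rfl⟩ _
  exact ⟨a ⊓ b, Iic_inter_Iic.symm⟩

theorem measure_pi_ext_of_Iic {d : ℕ} {μ ν : Measure (Fin d → I)} [IsFiniteMeasure μ]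
    (h : ∀ u, μ (Iic u) = ν (Iic u)) : μ = ν := by
  refine ext_of_generate_finite _ (measurableSpace_pi_eq_generateFrom_Iic d) (isPiSystem_range_Iic _) ?_ ?_
  · rintro _ ⟨u, rfl⟩
    exact h u
  · convert h 1 using 2 <;> ext u <;> simp [Pi.le_def, unitInterval.le_one']

theorem measure_prod_ext_of_Iic {l m : ℕ} {μ ν : Measure ((Fin l → I) × (Fin m → I))}
    [IsFiniteMeasure μ] (h : ∀ u v, μ (Iic u ×ˢ Iic v) = ν (Iic u ×ˢ Iic v)) : μ = ν := by
  refine ext_of_generate_finite _ (measurableSpace_prod_eq_generateFrom_Iic l m) (isPiSystem_range_Iic _) ?_ ?_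
  · rintro _ ⟨⟨u, v⟩, rfl⟩
    rw [← Iic_prod_Iic]
    exact h u v
  · convert h 1 1 using 2 <;> ext u <;> simp [Prod.le_def, Pi.le_def, unitInterval.le_one']

/-! ### Densities in the coordinates `z = φ(u)` -/

theorem setLIntegral_pi_Ioi_chain {j : ℕ} {g : ℕ → ℝ → ℝ}
    (hmeas : ∀ i, i < j → Measurable (g (i + 1)))
    (hstep : ∀ i, i < j → ∀ c, 0 < c →
      ∫⁻ t in Ioi c, ENNReal.ofReal (g (i + 1) t) = ENNReal.ofReal (g i c))
    (hzero : 0 < j → ∫⁻ t in Ioi 0, ENNReal.ofReal (g 1 t) = ENNReal.ofReal (g 0 0))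
    {a : Fin j → ℝ} (ha : ∀ i, 0 ≤ a i) {b : ℝ} (hb : 0 ≤ b) :
    ∫⁻ z in univ.pi fun i => Ioi (a i), ENNReal.ofReal (g j (∑ i, z i + b)) =
      ENNReal.ofReal (g 0 (∑ i, a i + b)) := by
  induction j generalizing b with
  | zero =>
    have : (univ.pi fun i : Fin 0 => Ioi (a i)) = univ := by ext; simp
    rw [this, Measure.restrict_univ, volume_pi, Measure.pi_of_empty _ a]
    simp
  | succ j ih =>
    have hm : Measurable fun z : Fin (j + 1) → ℝ => ENNReal.ofReal (g (j + 1) (∑ i, z i + b)) :=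
      ((hmeas j (by omega)).comp (by fun_prop)).ennreal_ofReal
    have hpi : ∀ {i : ℕ} (c : Fin i → ℝ), MeasurableSet (univ.pi fun i => Ioi (c i)) := fun c =>
      MeasurableSet.univ_pi fun i => measurableSet_Ioi
    rw [← lintegral_indicator (hpi a)]
    have hm' := hm.indicator (hpi a)
    have e := (volume_preserving_piFinSuccAbove (fun _ : Fin (j + 1) => ℝ) 0).symm
    rw [← e.lintegral_comp hm', Measure.volume_eq_prod, lintegral_prod_symm _ (by
      exact (hm'.comp (MeasurableEquiv.measurable _)).aemeasurable)]
    have hin : ∀ z' : Fin j → ℝ, ∫⁻ x : ℝ, (univ.pi fun i => Ioi (a i)).indicator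
        (fun z : Fin (j + 1) → ℝ => ENNReal.ofReal (g (j + 1) (∑ i, z i + b)))
        ((MeasurableEquiv.piFinSuccAbove (fun _ : Fin (j + 1) => ℝ) 0).symm (x, z')) =
        (univ.pi fun i : Fin j => Ioi (a i.succ)).indicator
        (fun z' => ENNReal.ofReal (g j (∑ i, z' i + (a 0 + b)))) z' := by
      intro z'
      have hsymm : ∀ x : ℝ, (MeasurableEquiv.piFinSuccAbove (fun _ : Fin (j + 1) => ℝ) 0).symm
          (x, z') = Fin.cons x z' := fun x => by
        simp [MeasurableEquiv.piFinSuccAbove, Fin.insertNthEquiv]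
      simp only [hsymm]
      by_cases hz' : z' ∈ univ.pi fun i : Fin j => Ioi (a i.succ)
      · rw [indicator_of_mem hz']
        have hz'' : ∀ i, a i.succ < z' i := fun i => hz' i (mem_univ i)
        have h1 : ∀ x : ℝ, (univ.pi fun i => Ioi (a i)).indicator
            (fun z : Fin (j + 1) → ℝ => ENNReal.ofReal (g (j + 1) (∑ i, z i + b)))
            (Fin.cons x z') = (Ioi (a 0 + (∑ i, z' i + b))).indicator
              (fun y => ENNReal.ofReal (g (j + 1) y)) (x + (∑ i, z' i + b)) := by
          intro x
          by_cases hx : a 0 < x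
          · rw [indicator_of_mem, indicator_of_mem (by simpa using hx), Fin.sum_univ_succ]
            · simp [add_assoc]
            · intro i _
              refine Fin.cases ?_ (fun i => ?_) i
              · simpa using hx
              · simpa using hz'' i
          · rw [indicator_of_notMem, indicator_of_notMem (by simpa using hx)]
            intro hc
            exact hx (by simpa using hc 0 (mem_univ 0))
        simp only [h1]
        rw [lintegral_add_right_eq_self (fun y => (Ioi (a 0 + (∑ i, z' i + b))).indicator
              (fun y => ENNReal.ofReal (g (j + 1) y)) y), lintegral_indicator measurableSet_Ioi]
        have hs : 0 ≤ ∑ i, z' i := Finset.sum_nonneg fun i _ => (ha i.succ).trans (hz'' i).le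
        have h0 := ha 0
        rcases (by positivity : 0 ≤ a 0 + (∑ i, z' i + b)).eq_or_lt with h | h
        · have hj : j = 0 := by
            by_contra hj
            have : 0 < ∑ i, z' i := Finset.sum_pos
              (fun i _ => (ha i.succ).trans_lt (hz'' i)) ⟨⟨0, by omega⟩, Finset.mem_univ _⟩
            linarith
          subst hj
          rw [← h, hzero (by omega), show ∑ i, z' i + (a 0 + b) = 0 by linarith]
        · rw [hstep j (by omega) _ h]
          congr 2
          ring
      · rw [indicator_of_notMem hz']
        rw [lintegral_eq_zero_iff' (by
          refine Measurable.aemeasurable (hm'.comp ?_)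
          exact measurable_pi_iff.2 (Fin.cases (by simpa using measurable_id') fun i => by simp))]
        refine Eventually.of_forall fun x => ?_
        refine indicator_of_notMem ?_ _
        exact fun hc => hz' fun i _ => by simpa using hc i.succ (mem_univ _)
    have hin' := lintegral_congr (μ := (volume : Measure (Fin j → ℝ))) hin
    refine Eq.trans hin' ?_
    rw [lintegral_indicator (hpi _), ih (fun i hi => hmeas i (by omega))
      (fun i hi => hstep i (by omega)) (fun h => hzero (by omega)) (fun i => ha i.succ)
      (add_nonneg (ha 0) hb), Fin.sum_univ_succ]
    congr 2
    ring

theorem IsStrictGenerator.setLIntegral_altDeriv_one {ψ : ℝ → ℝ} (h : IsStrictGenerator ψ)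
    (hψ : IsMultiplyMonotone 2 ψ) {a : ℝ} (ha : 0 ≤ a) :
    ∫⁻ t in Ioi a, ENNReal.ofReal (altDeriv ψ 1 t) = ENNReal.ofReal (ψ a) := by
  rcases ha.eq_or_lt with rfl | ha
  · let c : ℕ → ℝ := fun i => ((i : ℝ) + 1)⁻¹
    have hc : Antitone c := fun i j hij => by
      have : (i : ℝ) ≤ j := by exact_mod_cast hij
      simp only [c]
      gcongr
    have hc0 : Tendsto c atTop (𝓝 0) :=
      (tendsto_natCast_atTop_atTop.atTop_add tendsto_const_nhds).inv_tendsto_atTop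
    have hU : ⋃ i, Ioi (c i) = Ioi 0 := by
      ext t
      simp only [mem_iUnion, mem_Ioi]
      refine ⟨fun ⟨i, hi⟩ => lt_trans (by positivity) hi, fun ht => ?_⟩
      exact (hc0.eventually_lt_const ht).exists
    have hmono : Monotone fun i => Ioi (c i) := fun i j hij => Ioi_subset_Ioi (hc hij)
    have l1 : Tendsto (fun i => ∫⁻ t in Ioi (c i), ENNReal.ofReal (altDeriv ψ 1 t)) atTop
        (𝓝 (∫⁻ t in Ioi 0, ENNReal.ofReal (altDeriv ψ 1 t))) := by
      rw [← hU, setLIntegral_iUnion_of_directed _ hmono.directed_le]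
      exact tendsto_atTop_iSup fun i j hij => lintegral_mono_set (hmono hij)
    have l2 : Tendsto (fun i => ENNReal.ofReal (ψ (c i))) atTop (𝓝 (ENNReal.ofReal (ψ 0))) :=
      ENNReal.tendsto_ofReal ((h.continuousOn 0 self_mem_Ici).tendsto.comp
        (tendsto_nhdsWithin_iff.2 ⟨hc0, Eventually.of_forall fun i => mem_Ici.2 (by positivity)⟩))
    exact tendsto_nhds_unique l1
      (l2.congr fun i => (hψ.setLIntegral_altDeriv (j := 0) h.tendsto_zero (by positivity)).symm)
  · exact hψ.setLIntegral_altDeriv (j := 0) h.tendsto_zero ha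

theorem IsStrictGenerator.setLIntegral_pi_altDeriv {ψ : ℝ → ℝ} (h : IsStrictGenerator ψ)
    {j : ℕ} (hψ : IsMultiplyMonotone (1 + j) ψ) {a : Fin j → ℝ} (ha : ∀ i, 0 ≤ a i) {b : ℝ}
    (hb : 0 ≤ b) :
    ∫⁻ z in univ.pi fun i => Ioi (a i), ENNReal.ofReal (altDeriv ψ j (∑ i, z i + b)) =
      ENNReal.ofReal (ψ (∑ i, a i + b)) :=
  setLIntegral_pi_Ioi_chain (fun i _ => measurable_altDeriv ψ (by omega))
    (fun i hi c hc => (hψ.mono (by omega)).setLIntegral_altDeriv h.tendsto_zero hc)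
    (fun hj => h.setLIntegral_altDeriv_one (hψ.mono (by omega)) le_rfl) ha hb

theorem pi_absolutelyContinuous {n : ℕ} {μ ν : Measure ℝ} [SigmaFinite μ] [SigmaFinite ν]
    (h : μ ≪ ν) : Measure.pi (fun _ : Fin n => μ) ≪ Measure.pi fun _ : Fin n => ν := by
  induction n with
  | zero => rw [Measure.pi_of_empty _ 0, Measure.pi_of_empty _ 0]
  | succ n ih =>
    rw [← (measurePreserving_piFinSuccAbove (fun _ : Fin (n + 1) => μ) 0).symm.map_eq,
      ← (measurePreserving_piFinSuccAbove (fun _ : Fin (n + 1) => ν) 0).symm.map_eq]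
    exact (h.prod ih).map (MeasurableEquiv.measurable _)

/-- The Lebesgue measure on the open positive orthant. -/
noncomputable def orthantMeasure (n : ℕ) : Measure (Fin n → ℝ) :=
  volume.restrict (univ.pi fun _ => Ioi 0)

theorem measurableSet_orthant (n : ℕ) : MeasurableSet (univ.pi fun _ : Fin n => Ioi (0 : ℝ)) :=
  MeasurableSet.univ_pi fun _ => measurableSet_Ioi

theorem ae_orthantMeasure_pos (n : ℕ) : ∀ᵐ z ∂orthantMeasure n, ∀ i, 0 < z i := by
  filter_upwards [ae_restrict_mem (measurableSet_orthant n)] with z hz i using hz i (mem_univ i)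

/-- The point of the cube with coordinates `ψ (z i)`. -/
noncomputable def genCube (ψ : ℝ → ℝ) {n : ℕ} (z : Fin n → ℝ) : Fin n → I :=
  fun i => genUnit ψ (z i)

/-- `u ↦ ∑ φ(u i)`. -/
noncomputable def invSum (ψ : ℝ → ℝ) {n : ℕ} (u : Fin n → I) : ℝ := ∑ i, pseudoInv ψ (u i)

theorem invSum_nonneg (ψ : ℝ → ℝ) {n : ℕ} (u : Fin n → I) : 0 ≤ invSum ψ u :=
  Finset.sum_nonneg fun _ _ => pseudoInv_nonneg _ _

namespace IsStrictGenerator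

variable {ψ : ℝ → ℝ} {n : ℕ}

theorem continuous_genCube (h : IsStrictGenerator ψ) : Continuous (genCube ψ (n := n)) :=
  continuous_pi fun i => h.continuous_genUnit.comp (continuous_apply i)

theorem measurable_genCube (h : IsStrictGenerator ψ) : Measurable (genCube ψ (n := n)) :=
  h.continuous_genCube.measurable

theorem measurable_invSum (h : IsStrictGenerator ψ) : Measurable (invSum ψ (n := n)) :=
  Finset.measurable_sum _ fun i _ => h.measurable_pseudoInv.comp (measurable_pi_apply i)

theorem invSum_genCube (h : IsStrictGenerator ψ) {z : Fin n → ℝ} (hz : ∀ i, 0 ≤ z i) :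
    invSum ψ (genCube ψ z) = ∑ i, z i :=
  Finset.sum_congr rfl fun i _ => h.pseudoInv_genUnit (hz i)

theorem invSum_one (h : IsStrictGenerator ψ) : invSum ψ (1 : Fin n → I) = 0 :=
  Finset.sum_eq_zero fun _ _ => h.pseudoInv_one

theorem genCube_pseudoInv (h : IsStrictGenerator ψ) {u : Fin n → I} (hu : ∀ i, u i ≠ 0) :
    genCube ψ (fun i => pseudoInv ψ (u i)) = u :=
  funext fun i => h.genUnit_pseudoInv (hu i)

theorem map_withDensity_altDeriv_one (h : IsStrictGenerator ψ) (hψ : IsMultiplyMonotone 2 ψ) :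
    ((volume.restrict (Ioi 0)).withDensity fun t => ENNReal.ofReal (altDeriv ψ 1 t)).map
      (genUnit ψ) = (volume : Measure I) := by
  have hfin : IsFiniteMeasure
      ((volume.restrict (Ioi 0)).withDensity fun t => ENNReal.ofReal (altDeriv ψ 1 t)) := by
    refine isFiniteMeasure_withDensity ?_
    rw [h.setLIntegral_altDeriv_one hψ le_rfl]
    exact ENNReal.ofReal_ne_top
  refine Measure.ext_of_Iic _ _ fun u => ?_
  have hm : MeasurableSet (genUnit ψ ⁻¹' Iic u) := h.continuous_genUnit.measurable measurableSet_Iic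
  rw [Measure.map_apply h.continuous_genUnit.measurable measurableSet_Iic,
    withDensity_apply _ hm, Measure.restrict_restrict hm, unitInterval.volume_Iic]
  rcases eq_or_ne u 0 with rfl | hu
  · have : genUnit ψ ⁻¹' Iic 0 ∩ Ioi 0 = ∅ := by
      ext z
      simpa using fun hz => absurd hz (h.genUnit_pos z).ne'
    simp [this]
  · have : genUnit ψ ⁻¹' Iic u ∩ Ioi 0 = Ici (pseudoInv ψ u) ∩ Ioi 0 := by
      ext z
      simp only [mem_inter_iff, mem_preimage, mem_Iic, mem_Ici, mem_Ioi]
      exact and_congr_left fun hz => h.genUnit_le_iff hz.le hu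
    rw [this, setLIntegral_congr (t := Ioi (pseudoInv ψ u)),
      h.setLIntegral_altDeriv_one hψ (pseudoInv_nonneg _ _),
      h.apply_pseudoInv (unitInterval.pos_iff_ne_zero.2 hu) u.2.2]
    have e : Ioi (pseudoInv ψ u) = Ioi (pseudoInv ψ u) ∩ Ioi 0 :=
      (inter_eq_left.2 (Ioi_subset_Ioi (pseudoInv_nonneg _ _))).symm
    exact ((Ioi_ae_eq_Ici.symm).inter (ae_eq_refl _)).trans e.symm.eventuallyEq

/-- `genCube ψ` transports the Lebesgue measure class of the orthant to that of the cube. -/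
theorem exists_pi_map (h : IsStrictGenerator ψ) (hψ : IsMultiplyMonotone 2 ψ) :
    ∃ ρ : Measure (Fin n → ℝ), ρ ≪ orthantMeasure n ∧ orthantMeasure n ≪ ρ ∧
      ρ.map (genCube ψ) = (volume : Measure (Fin n → I)) := by
  set f : ℝ → ENNReal := fun t => ENNReal.ofReal (altDeriv ψ 1 t)
  set ρ : Measure ℝ := (volume.restrict (Ioi 0)).withDensity f
  have hf : Measurable f := (measurable_altDeriv ψ le_rfl).ennreal_ofReal
  have hρ : ρ.map (genUnit ψ) = volume := h.map_withDensity_altDeriv_one hψ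
  have hfin : IsFiniteMeasure ρ := by
    refine isFiniteMeasure_withDensity ?_
    rw [h.setLIntegral_altDeriv_one hψ le_rfl]
    exact ENNReal.ofReal_ne_top
  have e : orthantMeasure n = Measure.pi fun _ : Fin n => (volume : Measure ℝ).restrict (Ioi 0) := by
    rw [orthantMeasure, volume_pi, Measure.restrict_pi_pi]
  refine ⟨Measure.pi fun _ => ρ, ?_, ?_, ?_⟩
  · rw [e]
    exact pi_absolutelyContinuous (withDensity_absolutelyContinuous _ _)
  · rw [e]
    refine pi_absolutelyContinuous (withDensity_absolutelyContinuous' hf.aemeasurable ?_)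
    filter_upwards [ae_restrict_mem measurableSet_Ioi] with t ht
    have := (hψ.mono (m := 1 + 1) le_rfl).altDeriv_pos h.tendsto_zero (fun t ht => h.pos ht.le) ht
    simpa [f] using this
  · have : ∀ _ : Fin n, SigmaFinite (ρ.map (genUnit ψ)) := fun _ => by rw [hρ]; infer_instance
    change (Measure.pi fun _ : Fin n => ρ).map (fun z i => genUnit ψ (z i)) =
      (volume : Measure (Fin n → I))
    rw [Measure.pi_map_pi fun _ => h.continuous_genUnit.measurable.aemeasurable, volume_pi, hρ]

theorem volume_absolutelyContinuous_map (h : IsStrictGenerator ψ) (hψ : IsMultiplyMonotone 2 ψ) :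
    (volume : Measure (Fin n → I)) ≪ (orthantMeasure n).map (genCube ψ) := by
  obtain ⟨ρ, h1, -, h3⟩ := h.exists_pi_map hψ (n := n)
  rw [← h3]
  exact h1.map h.measurable_genCube

theorem map_absolutelyContinuous_volume (h : IsStrictGenerator ψ) (hψ : IsMultiplyMonotone 2 ψ) :
    (orthantMeasure n).map (genCube ψ) ≪ (volume : Measure (Fin n → I)) := by
  obtain ⟨ρ, -, h2, h3⟩ := h.exists_pi_map hψ (n := n)
  rw [← h3]
  exact h2.map h.measurable_genCube

/-- The density of the law of `z` under the copula with generator `ψ`. -/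
noncomputable def _root_.ArchCopula.radialMeasure (ψ : ℝ → ℝ) (n : ℕ) : Measure (Fin n → ℝ) :=
  (orthantMeasure n).withDensity fun z => ENNReal.ofReal (altDeriv ψ n (∑ i, z i))

theorem measurable_altDeriv_sum (ψ : ℝ → ℝ) (hn : 1 ≤ n) (b : ℝ) :
    Measurable fun z : Fin n → ℝ => altDeriv ψ n (∑ i, z i + b) :=
  (measurable_altDeriv ψ hn).comp (by fun_prop)

theorem setLIntegral_preimage_Iic (h : IsStrictGenerator ψ) (hψ : IsMultiplyMonotone (1 + n) ψ)
    {u : Fin n → I} (hu : ∀ i, u i ≠ 0) {b : ℝ} (hb : 0 ≤ b) :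
    ∫⁻ z in genCube ψ ⁻¹' Iic u, ENNReal.ofReal (altDeriv ψ n (∑ i, z i + b)) ∂orthantMeasure n =
      ENNReal.ofReal (ψ (invSum ψ u + b)) := by
  rw [invSum, ← h.setLIntegral_pi_altDeriv hψ (fun i => pseudoInv_nonneg ψ (u i)) hb, orthantMeasure,
    Measure.restrict_restrict (h.measurable_genCube measurableSet_Iic)]
  refine setLIntegral_congr ?_
  have e1 : genCube ψ ⁻¹' Iic u ∩ (univ.pi fun _ => Ioi 0) =
      (Ici fun i => pseudoInv ψ (u i)) ∩ (univ.pi fun _ => Ioi 0) := by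
    ext z
    refine and_congr_left fun hz => forall_congr' fun i => ?_
    exact h.genUnit_le_iff (le_of_lt (hz i (mem_univ i))) (hu i)
  have e2 : (univ.pi fun i => Ioi (pseudoInv ψ (u i))) =
      (univ.pi fun i => Ioi (pseudoInv ψ (u i))) ∩ (univ.pi fun _ => Ioi 0) :=
    (inter_eq_left.2 (pi_mono fun i _ => Ioi_subset_Ioi (pseudoInv_nonneg _ _))).symm
  rw [e1, e2, volume_pi]
  exact Measure.univ_pi_Ioi_ae_eq_Ici.symm.inter (ae_eq_refl _)

theorem preimage_Iic_of_eq_zero (h : IsStrictGenerator ψ) {u : Fin n → I} (hu : ∃ i, u i = 0) :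
    genCube ψ ⁻¹' Iic u = ∅ := by
  obtain ⟨i, hi⟩ := hu
  refine eq_empty_of_forall_notMem fun z hz => ?_
  have := hz i
  rw [hi] at this
  exact (h.genUnit_pos (z i)).not_ge this

theorem radialMeasure_absolutelyContinuous (ψ : ℝ → ℝ) (n : ℕ) :
    radialMeasure ψ n ≪ orthantMeasure n := withDensity_absolutelyContinuous _ _

theorem altDeriv_sum_pos (h : IsStrictGenerator ψ) (hψ : IsMultiplyMonotone (1 + n) ψ) (hn : 1 ≤ n)
    {z : Fin n → ℝ} (hz : ∀ i, 0 < z i) : 0 < altDeriv ψ n (∑ i, z i) :=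
  hψ.altDeriv_pos h.tendsto_zero (fun _ ht => h.pos ht.le)
    (Finset.sum_pos (fun i _ => hz i) ⟨⟨0, hn⟩, Finset.mem_univ _⟩)

theorem absolutelyContinuous_radialMeasure (h : IsStrictGenerator ψ)
    (hψ : IsMultiplyMonotone (1 + n) ψ) (hn : 1 ≤ n) : orthantMeasure n ≪ radialMeasure ψ n := by
  refine withDensity_absolutelyContinuous' ?_ ?_
  · simpa using (measurable_altDeriv_sum ψ hn 0).ennreal_ofReal.aemeasurable
  · filter_upwards [ae_orthantMeasure_pos n] with z hz
    simpa using h.altDeriv_sum_pos hψ hn hz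

end IsStrictGenerator

open Classical in
/-- The distribution function `v ↦ h(S + ∑ φ(v j)) / h(S)`. -/
noncomputable def radialCDF (ψ h : ℝ → ℝ) (S : ℝ) {m : ℕ} (v : Fin m → I) : ℝ :=
  if ∃ j, v j = 0 then 0 else h (S + invSum ψ v) / h S

namespace IsStrictArchimedean

variable {l m : ℕ} {C : (Fin (l + m) → I) → ℝ} {ψ : ℝ → ℝ}

theorem apply_append (hC : IsStrictArchimedean C ψ) {u : Fin l → I} {v : Fin m → I}
    (hu : ∀ i, u i ≠ 0) (hv : ∀ i, v i ≠ 0) :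
    C (Fin.append u v) = ψ (invSum ψ u + invSum ψ v) := by
  rw [hC.eq_archimedeanFn, archimedeanFn, if_neg, Fin.sum_univ_add]
  · simp [invSum]
  · rintro ⟨i, hi⟩
    refine Fin.addCases (fun i hi => ?_) (fun i hi => ?_) i hi
    · exact hu i (by simpa using hi)
    · exact hv i (by simpa using hi)

theorem apply_append_of_eq_zero (hC : IsStrictArchimedean C ψ) {u : Fin l → I} {v : Fin m → I}
    (h : (∃ i, u i = 0) ∨ ∃ i, v i = 0) : C (Fin.append u v) = 0 := by
  rw [hC.eq_archimedeanFn, archimedeanFn, if_pos]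
  rcases h with ⟨i, hi⟩ | ⟨i, hi⟩
  · exact ⟨Fin.castAdd m i, by simpa using hi⟩
  · exact ⟨Fin.natAdd l i, by simpa using hi⟩

theorem measurable_firstBlock : Measurable (firstBlock (l := l) (m := m)) :=
  measurable_pi_iff.2 fun _ => measurable_pi_apply _

theorem measurable_lastBlock : Measurable (lastBlock (l := l) (m := m)) :=
  measurable_pi_iff.2 fun _ => measurable_pi_apply _

theorem copulaMeasure_blocks (hC : IsStrictArchimedean C ψ) (u : Fin l → I) (v : Fin m → I) :
    copulaMeasure C ((fun w => (firstBlock w, lastBlock w)) ⁻¹' (Iic u ×ˢ Iic v)) =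
      ENNReal.ofReal (C (Fin.append u v)) := by
  rw [← hC.isCopula.copulaMeasure_Iic, ofReal_measureReal]
  congr 1
  ext w
  simp only [mem_preimage, mem_prod, mem_Iic, Pi.le_def, firstBlock, lastBlock]
  refine ⟨fun h i => ?_, fun h => ⟨fun i => ?_, fun i => ?_⟩⟩
  · refine Fin.addCases (fun i => ?_) (fun i => ?_) i
    · simpa using h.1 i
    · simpa using h.2 i
  · simpa using h (Fin.castAdd m i)
  · simpa using h (Fin.natAdd l i)

theorem marginalMeasure_eq (hC : IsStrictArchimedean C ψ) (hl : 1 ≤ l) (hm : 1 ≤ m) :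
    marginalMeasure C = (radialMeasure ψ l).map (genCube ψ) := by
  have h := hC.isStrictGenerator
  have hψ : IsMultiplyMonotone (1 + l) ψ := (hC.isMultiplyMonotone (by omega)).mono (by omega)
  have hfin : IsFiniteMeasure (marginalMeasure C) := by
    rw [marginalMeasure]; infer_instance
  refine measure_pi_ext_of_Iic fun u => ?_
  have h1 := hC.copulaMeasure_blocks u 1
  have e : (fun w : Fin (l + m) → I => (firstBlock w, lastBlock w)) ⁻¹' (Iic u ×ˢ Iic 1) =
      firstBlock ⁻¹' (Iic u) := by
    ext w
    simp [Pi.le_def, unitInterval.le_one']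
  rw [e] at h1
  rw [marginalMeasure, Measure.map_apply measurable_firstBlock measurableSet_Iic, h1,
    Measure.map_apply h.measurable_genCube measurableSet_Iic, radialMeasure]
  by_cases hu : ∃ i, u i = 0
  · rw [hC.apply_append_of_eq_zero (.inl hu), h.preimage_Iic_of_eq_zero hu]
    simp
  · push Not at hu
    rw [withDensity_apply _ (h.measurable_genCube measurableSet_Iic),
      hC.apply_append hu (v := 1) (fun _ => one_ne_zero), h.invSum_one]
    simpa using (h.setLIntegral_preimage_Iic hψ hu le_rfl).symm

theorem marginalMeasure_absolutelyContinuous (hC : IsStrictArchimedean C ψ) (hl : 1 ≤ l)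
    (hm : 1 ≤ m) : marginalMeasure C ≪ volume := by
  rw [hC.marginalMeasure_eq hl hm]
  exact ((IsStrictGenerator.radialMeasure_absolutelyContinuous ψ l).map
    hC.isStrictGenerator.measurable_genCube).trans
    (hC.isStrictGenerator.map_absolutelyContinuous_volume
      ((hC.isMultiplyMonotone (by omega)).mono (by omega)))

theorem absolutelyContinuous_marginalMeasure (hC : IsStrictArchimedean C ψ) (hl : 1 ≤ l)
    (hm : 1 ≤ m) : volume ≪ marginalMeasure C := by
  rw [hC.marginalMeasure_eq hl hm]
  exact (hC.isStrictGenerator.volume_absolutelyContinuous_map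
      ((hC.isMultiplyMonotone (by omega)).mono (by omega))).trans
    ((hC.isStrictGenerator.absolutelyContinuous_radialMeasure
      ((hC.isMultiplyMonotone (by omega)).mono (by omega)) hl).map
    hC.isStrictGenerator.measurable_genCube)

theorem measurable_radialCDF (hC : IsStrictArchimedean C ψ) (hl : 1 ≤ l) (v : Fin m → I) :
    Measurable fun s : Fin l → I => radialCDF ψ (altDeriv ψ l) (invSum ψ s) v := by
  have hm := measurable_altDeriv ψ hl
  have hi := hC.isStrictGenerator.measurable_invSum (n := l)
  unfold radialCDF
  split_ifs
  · exact measurable_const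
  · exact (hm.comp (hi.add_const _)).div (hm.comp hi)

theorem setLIntegral_radialCDF (hC : IsStrictArchimedean C ψ) (hl : 1 ≤ l) (hm : 1 ≤ m)
    (u : Fin l → I) (v : Fin m → I) :
    ∫⁻ s in Iic u, ENNReal.ofReal (radialCDF ψ (altDeriv ψ l) (invSum ψ s) v) ∂marginalMeasure C =
      ENNReal.ofReal (C (Fin.append u v)) := by
  have h := hC.isStrictGenerator
  have hψ : IsMultiplyMonotone (1 + l) ψ := (hC.isMultiplyMonotone (by omega)).mono (by omega)
  have hR := (hC.measurable_radialCDF hl v).ennreal_ofReal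
  have hd : Measurable fun z : Fin l → ℝ => ENNReal.ofReal (altDeriv ψ l (∑ i, z i)) := by
    simpa using (IsStrictGenerator.measurable_altDeriv_sum ψ hl 0).ennreal_ofReal
  rw [hC.marginalMeasure_eq hl hm, setLIntegral_map measurableSet_Iic hR h.measurable_genCube,
    radialMeasure, setLIntegral_withDensity_eq_setLIntegral_mul _ hd
      (g := fun z => ENNReal.ofReal (radialCDF ψ (altDeriv ψ l) (invSum ψ (genCube ψ z)) v))
      (hR.comp h.measurable_genCube) (h.measurable_genCube measurableSet_Iic)]
  by_cases hu : ∃ i, u i = 0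
  · rw [hC.apply_append_of_eq_zero (.inl hu), h.preimage_Iic_of_eq_zero hu]
    simp
  by_cases hv : ∃ i, v i = 0
  · rw [hC.apply_append_of_eq_zero (.inr hv)]
    simp [radialCDF, hv]
  push Not at hu
  rw [hC.apply_append hu (by simpa using hv), ← h.setLIntegral_preimage_Iic hψ hu (invSum_nonneg ψ v)]
  refine lintegral_congr_ae (ae_restrict_of_ae ?_)
  filter_upwards [ae_orthantMeasure_pos l] with z hz
  have hpos := h.altDeriv_sum_pos hψ hl hz
  simp only [Pi.mul_apply, radialCDF, if_neg hv,
    h.invSum_genCube (fun i => (hz i).le)]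
  rw [← ENNReal.ofReal_mul hpos.le, mul_div_cancel₀ _ hpos.ne']

theorem isMarkovKernelOf_iff (hC : IsStrictArchimedean C ψ) (hl : 1 ≤ l) (hm : 1 ≤ m)
    (K : Kernel (Fin l → I) (Fin m → I)) [IsMarkovKernel K] :
    IsMarkovKernelOf C K ↔ ∀ v, ∀ᵐ s, K s (Iic v) =
      ENNReal.ofReal (radialCDF ψ (altDeriv ψ l) (invSum ψ s) v) := by
  have hfin : IsFiniteMeasure (marginalMeasure C) := by
    rw [marginalMeasure]; infer_instance
  have hblocks : Measurable fun w : Fin (l + m) → I => (firstBlock w, lastBlock w) :=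
    measurable_firstBlock.prodMk measurable_lastBlock
  have h1 : IsMarkovKernelOf C K ↔ ∀ u v, ∫⁻ s in Iic u, K s (Iic v) ∂marginalMeasure C =
      ENNReal.ofReal (C (Fin.append u v)) := by
    have h2 : ∀ u v, (marginalMeasure C ⊗ₘ K) (Iic u ×ˢ Iic v) =
        ∫⁻ s in Iic u, K s (Iic v) ∂marginalMeasure C := fun u v =>
      Measure.compProd_apply_prod measurableSet_Iic measurableSet_Iic
    have h3 : ∀ u v, ((copulaMeasure C).map fun w : Fin (l + m) → I => (firstBlock w, lastBlock w))
        (Iic u ×ˢ Iic v) = ENNReal.ofReal (C (Fin.append u v)) := fun u v => by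
      rw [Measure.map_apply hblocks (measurableSet_Iic.prod measurableSet_Iic),
        hC.copulaMeasure_blocks]
    refine ⟨fun hK u v => ?_, fun hK => ⟨inferInstance, ⟨hblocks.aemeasurable, ?_⟩⟩⟩
    · rw [← h2, ← h3, hK.hasCondDistrib.map_eq, marginalMeasure]
    · refine measure_prod_ext_of_Iic fun u v => ?_
      rw [h3, ← hK, ← h2, marginalMeasure]
  have hae : ∀ v, (∀ᵐ s, K s (Iic v) =
      ENNReal.ofReal (radialCDF ψ (altDeriv ψ l) (invSum ψ s) v)) ↔ ∀ᵐ s ∂marginalMeasure C,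
      K s (Iic v) = ENNReal.ofReal (radialCDF ψ (altDeriv ψ l) (invSum ψ s) v) := fun v =>
    ⟨fun h => (hC.marginalMeasure_absolutelyContinuous hl hm).ae_le h,
      fun h => (hC.absolutelyContinuous_marginalMeasure hl hm).ae_le h⟩
  simp only [h1, hae]
  refine ⟨fun hK v => ?_, fun hK u v => ?_⟩
  · have hmK : Measurable fun s => K s (Iic v) := K.measurable_coe measurableSet_Iic
    have hmR := (hC.measurable_radialCDF hl v).ennreal_ofReal
    refine (withDensity_eq_iff_of_sigmaFinite hmK.aemeasurable hmR.aemeasurable).1 ?_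
    have : IsFiniteMeasure ((marginalMeasure C).withDensity fun s => K s (Iic v)) := by
      refine isFiniteMeasure_withDensity (ne_top_of_le_ne_top (measure_ne_top (marginalMeasure C) univ)
        ?_)
      calc ∫⁻ s, K s (Iic v) ∂marginalMeasure C ≤ ∫⁻ _, 1 ∂marginalMeasure C :=
            lintegral_mono fun s => prob_le_one
        _ = _ := by simp
    refine measure_pi_ext_of_Iic fun u => ?_
    rw [withDensity_apply _ measurableSet_Iic, withDensity_apply _ measurableSet_Iic, hK,
      hC.setLIntegral_radialCDF hl hm]
  · rw [← hC.setLIntegral_radialCDF hl hm]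
    exact lintegral_congr_ae (ae_restrict_of_ae (hK v))

end IsStrictArchimedean

namespace IsStrictArchimedean

variable {l m : ℕ} {C : (Fin (l + m) → I) → ℝ} {ψ : ℝ → ℝ}

theorem radialCDF_genCube (h : IsStrictGenerator ψ) (f : ℝ → ℝ) (S : ℝ) {a : Fin m → ℝ}
    (ha : ∀ i, 0 ≤ a i) : radialCDF ψ f S (genCube ψ a) = f (S + ∑ i, a i) / f S := by
  rw [radialCDF, if_neg, h.invSum_genCube ha]
  rintro ⟨j, hj⟩
  exact (h.genUnit_pos (a j)).ne' hj

/-- Some fibre of a version of the Markov kernel has the distribution function `radialCDF` along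
the rational points of the orthant. -/
theorem exists_measure_rat (hC : IsStrictArchimedean C ψ) (hl : 1 ≤ l) (hm : 1 ≤ m) {S : ℝ}
    (hS : 0 < S) : ∃ T, 0 < T ∧ T < S ∧ ∃ κ : Measure (Fin m → I), IsProbabilityMeasure κ ∧
      ∀ q : Fin m → ℚ, κ (Iic (genCube ψ fun i => (q i : ℝ))) =
        ENNReal.ofReal (radialCDF ψ (altDeriv ψ l) T (genCube ψ fun i => (q i : ℝ))) := by
  have h := hC.isStrictGenerator
  set K := condDistrib (lastBlock (l := l) (m := m)) firstBlock (copulaMeasure C) with hK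
  have hMK : IsMarkovKernelOf C K := by
    refine ⟨inferInstance, (measurable_firstBlock.prodMk measurable_lastBlock).aemeasurable, ?_⟩
    rw [hK, compProd_map_condDistrib measurable_lastBlock.aemeasurable]
  have h1 : ∀ᵐ s : Fin l → I, ∀ q : Fin m → ℚ, K s (Iic (genCube ψ fun i => (q i : ℝ))) =
      ENNReal.ofReal (radialCDF ψ (altDeriv ψ l) (invSum ψ s) (genCube ψ fun i => (q i : ℝ))) :=
    ae_all_iff.2 fun q => (hC.isMarkovKernelOf_iff hl hm K).1 hMK _
  have h2 := ae_of_ae_map h.measurable_genCube.aemeasurable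
    ((h.map_absolutelyContinuous_volume ((hC.isMultiplyMonotone (by omega)).mono (by omega))).ae_le h1)
  set B : Set (Fin l → ℝ) := univ.pi fun _ => Ioo 0 (S / (l + 1)) with hB
  have hBpos : orthantMeasure l B ≠ 0 := by
    have hsub : B ⊆ univ.pi fun _ => Ioi 0 := pi_mono fun _ _ => Ioo_subset_Ioi_self
    rw [orthantMeasure, Measure.restrict_eq_self _ hsub, hB, volume_pi, Measure.pi_pi]
    refine Finset.prod_ne_zero_iff.2 fun i _ => ?_
    have : 0 < S / (l + 1) := by positivity
    simpa using this
  obtain ⟨z, hz, hzK⟩ := Measure.exists_mem_of_measure_ne_zero_of_ae hBpos (ae_restrict_of_ae h2)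
  have hz0 : ∀ i, 0 < z i := fun i => (hz i (mem_univ i)).1
  refine ⟨∑ i, z i, Finset.sum_pos (fun i _ => hz0 i) ⟨⟨0, hl⟩, Finset.mem_univ _⟩, ?_,
    K (genCube ψ z), inferInstance, ?_⟩
  · calc ∑ i, z i ≤ ∑ _i : Fin l, S / (l + 1) :=
          Finset.sum_le_sum fun i _ => (hz i (mem_univ i)).2.le
      _ = l * (S / (l + 1)) := by simp
      _ < S := by
        rw [← mul_div_assoc, div_lt_iff₀ (by positivity)]
        nlinarith
  · simpa only [h.invSum_genCube fun i => (hz0 i).le] using hzK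

theorem exists_measure_real (hC : IsStrictArchimedean C ψ) (hl : 1 ≤ l) (hm : 2 ≤ m) {S : ℝ}
    (hS : 0 < S) : ∃ T, 0 < T ∧ T < S ∧ ∃ κ : Measure (Fin m → I), IsProbabilityMeasure κ ∧
      ∀ a : Fin m → ℝ, (∀ i, 0 ≤ a i) → κ (Iic (genCube ψ a)) =
        ENNReal.ofReal (altDeriv ψ l (T + ∑ i, a i) / altDeriv ψ l T) := by
  have h := hC.isStrictGenerator
  obtain ⟨T, hT, hTS, κ, hκ, hq⟩ := hC.exists_measure_rat hl (by omega) hS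
  refine ⟨T, hT, hTS, κ, hκ, fun a ha => ?_⟩
  have hq' : ∀ q : Fin m → ℚ, (∀ i, 0 ≤ q i) → κ (Iic (genCube ψ fun i => (q i : ℝ))) =
      ENNReal.ofReal (altDeriv ψ l (T + ∑ i, (q i : ℝ)) / altDeriv ψ l T) := fun q hq0 => by
    rw [hq, radialCDF_genCube h _ _ fun i => by exact_mod_cast hq0 i]
  have hcont : ContinuousAt (altDeriv ψ l) (T + ∑ i, a i) := by
    have h1 : IsMultiplyMonotone (0 + 2) (altDeriv ψ l) :=
      IsMultiplyMonotone.altDeriv (n := 1) ((hC.isMultiplyMonotone (by omega)).mono (by omega))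
    exact h1.continuousOn.continuousAt
      (Ioi_mem_nhds (add_pos_of_pos_of_nonneg hT (Finset.sum_nonneg fun i _ => ha i)))
  have hlim : ∀ q : ℕ → Fin m → ℚ, (∀ i, Tendsto (fun n => (q n i : ℝ)) atTop (𝓝 (a i))) →
      Tendsto (fun n => ENNReal.ofReal (altDeriv ψ l (T + ∑ i, (q n i : ℝ)) / altDeriv ψ l T)) atTop
        (𝓝 (ENNReal.ofReal (altDeriv ψ l (T + ∑ i, a i) / altDeriv ψ l T))) := fun q hqa =>
    ENNReal.tendsto_ofReal ((hcont.tendsto.comp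
      ((tendsto_finsetSum _ fun i _ => hqa i).const_add T)).div_const _)
  have hanti : ∀ {b c : Fin m → ℝ}, (∀ i, b i ≤ c i) →
      κ (Iic (genCube ψ c)) ≤ κ (Iic (genCube ψ b)) := fun hbc =>
    measure_mono (Iic_subset_Iic.2 fun i => h.antitone_genUnit (hbc i))
  let q : ℕ → Fin m → ℚ := fun n i => (⌊a i * n⌋₊ : ℚ) / n
  have hqa : ∀ i, Tendsto (fun n => (q n i : ℝ)) atTop (𝓝 (a i)) := fun i => by
    have := (tendsto_nat_floor_mul_div_atTop (ha i)).comp tendsto_natCast_atTop_atTop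
    refine this.congr fun n => ?_
    simp [q]
  let r : ℕ → Fin m → ℚ := fun n i => q n i + 1 / n
  have hra : ∀ i, Tendsto (fun n => (r n i : ℝ)) atTop (𝓝 (a i)) := fun i => by
    have := (hqa i).add (tendsto_one_div_atTop_nhds_zero_nat (𝕜 := ℝ))
    rw [add_zero] at this
    refine this.congr fun n => ?_
    simp [r]
  have hq0 : ∀ n i, 0 ≤ q n i := fun n i => by positivity
  refine le_antisymm (ge_of_tendsto (hlim q hqa) (Eventually.of_forall fun n => ?_))
    (le_of_tendsto (hlim r hra) ?_)
  · rw [← hq' _ (hq0 n)]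
    refine hanti fun i => ?_
    rcases Nat.eq_zero_or_pos n with rfl | hn
    · simpa [q] using ha i
    · simp only [q, Rat.cast_div, Rat.cast_natCast]
      rw [div_le_iff₀ (by exact_mod_cast hn)]
      exact Nat.floor_le (mul_nonneg (ha i) (by positivity))
  · filter_upwards [eventually_gt_atTop 0] with n hn
    have hn' : (0 : ℝ) < n := by exact_mod_cast hn
    rw [← hq' _ fun i => add_nonneg (hq0 n i) (by positivity)]
    refine hanti fun i => ?_
    simp only [q, Rat.cast_add, Rat.cast_div, Rat.cast_natCast, Rat.cast_one]
    rw [← add_div, le_div_iff₀ hn']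
    exact (Nat.lt_floor_add_one _).le

open Classical in
/-- The map of the unit interval that corresponds to `z ↦ ζ(z)` under `u = ψ(z)`, `u' = η(ζ(z))`. -/
noncomputable def _root_.ArchCopula.genTransform (ψ η ζ : ℝ → ℝ) (t : I) : I :=
  if t = 0 then 0 else genUnit η (ζ (pseudoInv ψ t))

theorem _root_.ArchCopula.IsStrictGenerator.measurable_genTransform {η ζ : ℝ → ℝ}
    (h : IsStrictGenerator ψ) (hη : IsStrictGenerator η) (hζ : Measurable ζ) :
    Measurable (genTransform ψ η ζ) :=
  Measurable.ite (measurableSet_singleton 0) measurable_const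
    (hη.continuous_genUnit.measurable.comp (hζ.comp h.measurable_pseudoInv))

theorem exists_measure (hC : IsStrictArchimedean C ψ) (hl : 1 ≤ l) (hm : 2 ≤ m) {S : ℝ}
    (hS : 0 < S) : ∃ κ : Measure (Fin m → I), IsProbabilityMeasure κ ∧
      ∀ v, κ (Iic v) = ENNReal.ofReal (radialCDF ψ (altDeriv ψ l) S v) := by
  have h := hC.isStrictGenerator
  have hmono : IsMultiplyMonotone (1 + l) ψ := (hC.isMultiplyMonotone (by omega)).mono (by omega)
  have hpos : ∀ t, 0 < t → 0 < altDeriv ψ l t := fun t ht =>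
    hmono.altDeriv_pos h.tendsto_zero (fun t ht => h.pos ht.le) ht
  obtain ⟨T, hT, hTS, κ, hκ, ha⟩ := hC.exists_measure_real hl hm hS
  set i₀ : Fin m := ⟨0, by omega⟩
  set δ := S - T with hδ
  have hδ0 : 0 < δ := sub_pos.2 hTS
  set B : Set (Fin m → I) := Iic (genCube ψ (Pi.single i₀ δ)) with hB
  have hBm : MeasurableSet B := measurableSet_Iic
  have hsingle : ∀ i, 0 ≤ (Pi.single i₀ δ : Fin m → ℝ) i := fun i => by
    by_cases hi : i = i₀
    · rw [hi, Pi.single_eq_same]; exact hδ0.le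
    · rw [Pi.single_eq_of_ne hi]
  have hκB : κ B = ENNReal.ofReal (altDeriv ψ l S / altDeriv ψ l T) := by
    rw [hB, ha _ hsingle, Finset.sum_pi_single' i₀ δ, if_pos (Finset.mem_univ _), hδ, add_sub_cancel]
  have hκB0 : κ B ≠ 0 := by
    rw [hκB]
    simpa using div_pos (hpos S hS) (hpos T hT)
  let W : (Fin m → I) → Fin m → I := fun u =>
    Function.update u i₀ (genTransform ψ ψ (fun z => z - δ) (u i₀))
  have hW : Measurable W := by
    refine measurable_pi_iff.2 fun i => ?_
    by_cases hi : i = i₀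
    · subst hi
      have := (h.measurable_genTransform h (measurable_id.sub_const δ)).comp
        (measurable_pi_apply (X := fun _ : Fin m => I) i₀)
      simpa [W, Function.comp_def] using this
    · simpa [W, hi] using measurable_pi_apply i
  have hcond : IsProbabilityMeasure (κ[|B]) := cond_isProbabilityMeasure hκB0
  have key : ∀ a : Fin m → ℝ, (∀ i, 0 ≤ a i) → (κ[|B]).map W (Iic (genCube ψ a)) =
      ENNReal.ofReal (altDeriv ψ l (S + ∑ i, a i) / altDeriv ψ l S) := by
    intro a ha0
    have hset : B ∩ W ⁻¹' Iic (genCube ψ a) = Iic (genCube ψ (a + Pi.single i₀ δ)) := by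
      have hcoord : ∀ t : I, t ≤ genUnit ψ δ ∧
          genTransform ψ ψ (fun z => z - δ) t ≤ genUnit ψ (a i₀) ↔ t ≤ genUnit ψ (a i₀ + δ) := by
        intro t
        have h0 := ha0 i₀
        by_cases ht : t = 0
        · simp [ht, genTransform]
        · rw [genTransform, if_neg ht, h.le_genUnit_iff hδ0.le ht, h.le_genUnit_iff (by positivity) ht]
          constructor
          · rintro ⟨h1, h2⟩
            rw [h.genUnit_le_genUnit (sub_nonneg.2 h1) h0] at h2
            linarith
          · intro h1
            have h2 : δ ≤ pseudoInv ψ t := by linarith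
            refine ⟨h2, ?_⟩
            rw [h.genUnit_le_genUnit (sub_nonneg.2 h2) h0]
            linarith
      ext u
      simp only [hB, mem_inter_iff, mem_Iic, mem_preimage, Pi.le_def, genCube, ← forall_and]
      refine forall_congr' fun i => ?_
      by_cases hi : i = i₀
      · subst hi
        simpa [W] using hcoord (u i₀)
      · simp [W, hi, h.genUnit_zero, unitInterval.le_one']
    rw [Measure.map_apply hW measurableSet_Iic, cond_apply hBm, hset,
      ha (a + (Pi.single i₀ δ : Fin m → ℝ)) fun i => add_nonneg (ha0 i) (hsingle i), hκB, ← ENNReal.ofReal_inv_of_pos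
        (div_pos (hpos S hS) (hpos T hT)), ← ENNReal.ofReal_mul
        (inv_nonneg.2 (div_pos (hpos S hS) (hpos T hT)).le)]
    congr 1
    have e : T + ∑ i, (a + Pi.single i₀ δ : Fin m → ℝ) i = S + ∑ i, a i := by
      simp only [Pi.add_apply, Finset.sum_add_distrib]
      rw [Finset.sum_pi_single' i₀ δ, if_pos (Finset.mem_univ _), hδ]
      ring
    rw [e]
    have h1 := (hpos S hS).ne'
    have h2 := (hpos T hT).ne'
    field_simp
  refine ⟨(κ[|B]).map W, Measure.isProbabilityMeasure_map hW.aemeasurable, fun v => ?_⟩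
  by_cases hv : ∃ j, v j = 0
  · rw [radialCDF, if_pos hv, ENNReal.ofReal_zero]
    obtain ⟨j, hj⟩ := hv
    have hlim : Tendsto (fun n : ℕ => ENNReal.ofReal (altDeriv ψ l (S + n) / altDeriv ψ l S)) atTop
        (𝓝 0) := by
      have := ((hmono.tendsto_altDeriv_atTop h.tendsto_zero).comp
        (tendsto_atTop_add_const_left _ S tendsto_natCast_atTop_atTop)).div_const (altDeriv ψ l S)
      simpa using ENNReal.tendsto_ofReal this
    refine le_antisymm (ge_of_tendsto' hlim fun n => ?_) zero_le
    have := key (Pi.single j (n : ℝ)) fun i => by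
      by_cases hi : i = j
      · rw [hi, Pi.single_eq_same]; positivity
      · rw [Pi.single_eq_of_ne hi]
    rw [Finset.sum_pi_single' j (n : ℝ), if_pos (Finset.mem_univ _)] at this
    rw [← this]
    refine measure_mono (Iic_subset_Iic.2 fun i => ?_)
    by_cases hi : i = j
    · rw [hi, hj]; exact unitInterval.nonneg'
    · simp [genCube, hi, h.genUnit_zero, unitInterval.le_one']
  · push Not at hv
    have := key (fun i => pseudoInv ψ (v i)) fun i => pseudoInv_nonneg _ _
    rw [h.genCube_pseudoInv hv] at this
    rw [this, radialCDF, if_neg (by simpa using hv), invSum]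

theorem ae_invSum_pos (hC : IsStrictArchimedean C ψ) (hl : 1 ≤ l) (hm : 1 ≤ m) :
    ∀ᵐ s : Fin l → I, 0 < invSum ψ s := by
  have h := hC.isStrictGenerator
  refine (h.volume_absolutelyContinuous_map
    ((hC.isMultiplyMonotone (by omega)).mono (by omega))).ae_le ?_
  refine (ae_map_iff h.measurable_genCube.aemeasurable
    (measurableSet_lt measurable_const h.measurable_invSum)).2 ?_
  filter_upwards [ae_orthantMeasure_pos l] with z hz
  rw [h.invSum_genCube fun i => (hz i).le]
  exact Finset.sum_pos (fun i _ => hz i) ⟨⟨0, hl⟩, Finset.mem_univ _⟩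

theorem exists_kernel (hC : IsStrictArchimedean C ψ) (hl : 1 ≤ l) (hm : 2 ≤ m) :
    ∃ K : Kernel (Fin l → I) (Fin m → I), IsMarkovKernelOf C K ∧ ∀ s, 0 < invSum ψ s → ∀ v,
      K s (Iic v) = ENNReal.ofReal (radialCDF ψ (altDeriv ψ l) (invSum ψ s) v) := by
  classical
  have h := hC.isStrictGenerator
  choose! κ hκ hκv using fun S (hS : 0 < S) => hC.exists_measure hl hm hS
  let k : (Fin l → I) → Measure (Fin m → I) := fun s =>
    if 0 < invSum ψ s then κ (invSum ψ s) else Measure.dirac 0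
  have hk : ∀ s, IsProbabilityMeasure (k s) := fun s => by
    by_cases hs : 0 < invSum ψ s
    · simp only [k, if_pos hs]; exact hκ _ hs
    · simp only [k, if_neg hs]; infer_instance
  have hset : MeasurableSet {s : Fin l → I | 0 < invSum ψ s} :=
    measurableSet_lt measurable_const h.measurable_invSum
  have hkm : Measurable k := by
    refine Measurable.measure_of_isPiSystem_of_isProbabilityMeasure
      (measurableSpace_pi_eq_generateFrom_Iic m) (isPiSystem_range_Iic _) ?_
    rintro _ ⟨v, rfl⟩
    have : (fun s => k s (Iic v)) = fun s => if 0 < invSum ψ s then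
        ENNReal.ofReal (radialCDF ψ (altDeriv ψ l) (invSum ψ s) v) else
        Measure.dirac (0 : Fin m → I) (Iic v) := by
      ext s
      by_cases hs : 0 < invSum ψ s
      · simp only [k, if_pos hs, hκv _ hs]
      · simp only [k, if_neg hs]
    rw [this]
    exact Measurable.ite hset (hC.measurable_radialCDF hl v).ennreal_ofReal measurable_const
  let K : Kernel (Fin l → I) (Fin m → I) := ⟨k, hkm⟩
  have hK : IsMarkovKernel K := ⟨hk⟩
  have hval : ∀ s, 0 < invSum ψ s → ∀ v,
      K s (Iic v) = ENNReal.ofReal (radialCDF ψ (altDeriv ψ l) (invSum ψ s) v) := fun s hs v => by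
    change k s (Iic v) = _
    simp only [k, if_pos hs, hκv _ hs]
  refine ⟨K, (hC.isMarkovKernelOf_iff hl (by omega) K).2 fun v => ?_, hval⟩
  filter_upwards [hC.ae_invSum_pos hl (by omega)] with s hs using hval s hs v

theorem invSum_pos (h : IsStrictGenerator ψ) (hl : 1 ≤ l) {x : Fin l → I}
    (hx : ∀ i, x i ∈ Ioo 0 1) : 0 < invSum ψ x :=
  Finset.sum_pos (fun i _ => h.pseudoInv_pos (hx i).1.ne' (hx i).2.ne)
    ⟨⟨0, hl⟩, Finset.mem_univ _⟩

theorem archCondCDF_eq (hC : IsStrictArchimedean C ψ) (hl : 1 ≤ l) (hm : 2 ≤ m)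
    {x : Fin l → I} (hx : ∀ i, x i ∈ Ioo 0 1) :
    archCondCDF ψ x = radialCDF ψ (altDeriv ψ l) (invSum ψ x) (m := m) := by
  ext v
  have hmono : IsMultiplyMonotone (2 + l) ψ := (hC.isMultiplyMonotone (by omega)).mono (by omega)
  have hS := invSum_pos hC.isStrictGenerator hl hx
  have h1 : ∑ i, pseudoInv ψ (x i) = invSum ψ x := rfl
  have h2 : ∑ i, pseudoInv ψ (v i) = invSum ψ v := rfl
  rw [archCondCDF, radialCDF, h1, h2, hmono.iteratedDeriv_eq hS,
    hmono.iteratedDeriv_eq (add_pos_of_pos_of_nonneg hS (invSum_nonneg ψ v)),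
    mul_div_mul_left _ _ (by positivity)]

theorem radialCDF_nonneg (hC : IsStrictArchimedean C ψ) (hm : 1 ≤ m) {S : ℝ} (hS : 0 < S)
    {n : ℕ} (v : Fin n → I) : 0 ≤ radialCDF ψ (altDeriv ψ l) S v := by
  have hmono : IsMultiplyMonotone (1 + l) ψ := (hC.isMultiplyMonotone (by omega)).mono (by omega)
  have hpos : ∀ t, 0 < t → 0 < altDeriv ψ l t := fun t ht =>
    hmono.altDeriv_pos hC.isStrictGenerator.tendsto_zero
      (fun t ht => hC.isStrictGenerator.pos ht.le) ht
  unfold radialCDF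
  split_ifs
  · exact le_rfl
  · exact div_nonneg (hpos _ (add_pos_of_pos_of_nonneg hS (invSum_nonneg ψ v))).le (hpos _ hS).le

end IsStrictArchimedean

/-! ### Conditional copulas -/

/-- The generator `z ↦ f(S + z) / f(S)` of a conditional copula, with `f = (-1)^l ψ^(l)`. -/
noncomputable def condGenerator (ψ : ℝ → ℝ) (l : ℕ) (S z : ℝ) : ℝ :=
  altDeriv ψ l (S + z) / altDeriv ψ l S

namespace IsStrictArchimedean

variable {l m : ℕ} {C : (Fin (l + m) → I) → ℝ} {ψ : ℝ → ℝ}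

theorem isStrictGenerator_condGenerator (hC : IsStrictArchimedean C ψ) (hm : 2 ≤ m) {S : ℝ}
    (hS : 0 < S) : IsStrictGenerator (condGenerator ψ l S) := by
  have h := hC.isStrictGenerator
  have hmono : IsMultiplyMonotone (2 + l) ψ := (hC.isMultiplyMonotone (by omega)).mono (by omega)
  have hpos : ∀ t, 0 < t → 0 < altDeriv ψ l t := fun t ht =>
    (hmono.mono (by omega)).altDeriv_pos h.tendsto_zero (fun t ht => h.pos ht.le) ht
  have hlt : StrictAntiOn (condGenerator ψ l S) (Ici 0) := fun a ha b _ hab => by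
    have ha : 0 ≤ a := ha
    exact div_lt_div_of_pos_right (hmono.altDeriv_lt h.tendsto_zero (fun t ht => h.pos ht.le)
      (by positivity) (by linarith)) (hpos S hS)
  have h2 : IsMultiplyMonotone (0 + 2) (altDeriv ψ l) :=
    IsMultiplyMonotone.altDeriv (n := 1) (hmono.mono (by omega))
  refine ⟨⟨?_, hlt.antitoneOn, ?_, ?_, hlt.mono fun z hz => hz.1⟩, fun z hz => ?_⟩
  · refine ContinuousOn.div_const (h2.continuousOn.comp (by fun_prop) fun z hz => ?_) _
    exact mem_Ioi.2 (add_pos_of_pos_of_nonneg hS hz)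
  · rw [condGenerator, add_zero, div_self (hpos S hS).ne']
  · have := (((hmono.mono (m := 1 + l) (by omega)).tendsto_altDeriv_atTop h.tendsto_zero).comp
        (tendsto_atTop_add_const_left _ S tendsto_id)).div_const (altDeriv ψ l S)
    rw [zero_div] at this
    exact this
  · exact (div_pos (hpos _ (add_pos_of_pos_of_nonneg hS hz)) (hpos S hS)).ne'

end IsStrictArchimedean

namespace IsStrictGenerator

variable {ψ : ℝ → ℝ} {l m : ℕ} {S : ℝ}

theorem coe_genTransform {η : ℝ → ℝ} (hη : IsStrictGenerator η) (t : I) [Decidable (t = 0)] :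
    (genTransform ψ η id t : ℝ) = if t = 0 then 0 else η (pseudoInv ψ t) := by
  rw [genTransform]
  split_ifs
  · rfl
  · exact hη.coe_genUnit (pseudoInv_nonneg _ _)

theorem genTransform_eq_zero {η : ℝ → ℝ} (hη : IsStrictGenerator η) {t : I} :
    genTransform ψ η id t = 0 ↔ t = 0 := by
  rw [genTransform]
  split_ifs with ht
  · simp [ht]
  · simpa [ht] using (hη.genUnit_pos _).ne'

theorem margin_radialCDF (h : IsStrictGenerator ψ)
    (hη : IsStrictGenerator (condGenerator ψ l S)) (j : Fin m) (t : I) :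
    margin (radialCDF ψ (altDeriv ψ l) S) j t = genTransform ψ (condGenerator ψ l S) id t := by
  classical
  have h1 : (∃ i, Function.update (fun _ : Fin m => (1 : I)) j t i = 0) ↔ t = 0 := by
    refine ⟨fun ⟨i, hi⟩ => ?_, fun ht => ⟨j, by simpa using ht⟩⟩
    by_cases hij : i = j
    · subst hij; simpa using hi
    · simp [hij] at hi
  have h2 : invSum ψ (Function.update (fun _ : Fin m => (1 : I)) j t) = pseudoInv ψ t := by
    rw [invSum, Finset.sum_eq_single j]
    · simp
    · intro i _ hij
      simp [hij, h.pseudoInv_one]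
    · simp
  rw [margin, radialCDF, h2, coe_genTransform hη]
  simp only [h1, condGenerator]

theorem genTransform_le_iff {η : ℝ → ℝ} (h : IsStrictGenerator ψ) (hη : IsStrictGenerator η)
    (t u : I) : genTransform ψ η id t ≤ u ↔ t ≤ genTransform η ψ id u := by
  by_cases ht : t = 0
  · simp [ht, genTransform]
  by_cases hu : u = 0
  · have := hη.genUnit_pos (pseudoInv ψ t)
    simp [genTransform, hu, ht, this.ne']
  · rw [genTransform, genTransform, if_neg ht, if_neg hu, id, id,
      hη.genUnit_le_iff (pseudoInv_nonneg _ _) hu, h.le_genUnit_iff (pseudoInv_nonneg _ _) ht]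

theorem sklarCopula_radialCDF (h : IsStrictGenerator ψ)
    (hη : IsStrictGenerator (condGenerator ψ l S)) (u : Fin m → I) :
    sklarCopula (radialCDF ψ (altDeriv ψ l) S) u =
      radialCDF ψ (altDeriv ψ l) S fun j => genTransform (condGenerator ψ l S) ψ id (u j) := by
  rw [sklarCopula]
  congr 1
  ext1 j
  have hset : {t : I | (u j : ℝ) ≤ margin (radialCDF ψ (altDeriv ψ l) S) j t} =
      Ici (genTransform (condGenerator ψ l S) ψ id (u j)) := by
    ext t
    rw [mem_Ici, mem_ofPred_eq, h.margin_radialCDF hη, Subtype.coe_le_coe,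
      hη.genTransform_le_iff h]
  rw [hset]
  exact csInf_Ici

theorem sklarCopula_eq_archimedeanFn (h : IsStrictGenerator ψ)
    (hη : IsStrictGenerator (condGenerator ψ l S)) (u : Fin m → I) :
    sklarCopula (radialCDF ψ (altDeriv ψ l) S) u = archimedeanFn (condGenerator ψ l S) u := by
  rw [h.sklarCopula_radialCDF hη, radialCDF, archimedeanFn]
  simp only [genTransform_eq_zero h]
  split_ifs with hu
  · rfl
  · push Not at hu
    rw [condGenerator, invSum]
    congr 3
    refine Finset.sum_congr rfl fun i _ => ?_
    rw [genTransform, if_neg (hu i), id, h.pseudoInv_genUnit (pseudoInv_nonneg _ _)]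

theorem archimedeanFn_update {η : ℝ → ℝ} (hη : IsStrictGenerator η) (j : Fin m) (t : I) :
    archimedeanFn η (Function.update 1 j t) = t := by
  have h1 : (∃ i, Function.update (1 : Fin m → I) j t i = 0) ↔ t = 0 := by
    refine ⟨fun ⟨i, hi⟩ => ?_, fun ht => ⟨j, by simpa using ht⟩⟩
    by_cases hij : i = j
    · subst hij; simpa using hi
    · simp [hij] at hi
  rw [archimedeanFn]
  simp only [h1]
  split_ifs with ht
  · simp [ht]
  · rw [Finset.sum_eq_single j]
    · simpa using hη.apply_pseudoInv (unitInterval.pos_iff_ne_zero.2 ht) t.2.2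
    · intro i _ hij
      simp [hij, hη.pseudoInv_one]
    · simp

end IsStrictGenerator

namespace IsStrictArchimedean

variable {l m : ℕ} {C : (Fin (l + m) → I) → ℝ} {ψ : ℝ → ℝ}

theorem isCopula_sklarCopula (hC : IsStrictArchimedean C ψ) (hl : 1 ≤ l) (hm : 2 ≤ m) {S : ℝ}
    (hS : 0 < S) : IsCopula (sklarCopula (m := m) (radialCDF ψ (altDeriv ψ l) S)) := by
  have h := hC.isStrictGenerator
  have hη := hC.isStrictGenerator_condGenerator hm hS
  obtain ⟨κ, hκ, hκv⟩ := hC.exists_measure hl hm hS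
  let W : (Fin m → I) → Fin m → I := fun v j => genTransform ψ (condGenerator ψ l S) id (v j)
  have hW : Measurable W := measurable_pi_iff.2 fun j =>
    (h.measurable_genTransform hη measurable_id).comp (measurable_pi_apply j)
  have hval : ∀ u, κ.map W (Iic u) =
      ENNReal.ofReal (sklarCopula (radialCDF ψ (altDeriv ψ l) S) u) := fun u => by
    rw [Measure.map_apply hW measurableSet_Iic, h.sklarCopula_radialCDF hη, ← hκv]
    congr 1
    ext v
    exact forall_congr' fun j => h.genTransform_le_iff hη _ _
  have hprob : IsProbabilityMeasure (κ.map W) := Measure.isProbabilityMeasure_map hW.aemeasurable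
  refine ⟨κ.map W, ⟨hprob, fun j => ?_⟩, fun u => ?_⟩
  · have : IsProbabilityMeasure ((κ.map W).map fun z => z j) :=
      Measure.isProbabilityMeasure_map (measurable_pi_apply j).aemeasurable
    refine Measure.ext_of_Iic _ _ fun t => ?_
    rw [Measure.map_apply (measurable_pi_apply j) measurableSet_Iic, unitInterval.volume_Iic]
    have hset : (fun z : Fin m → I => z j) ⁻¹' Iic t =
        Iic (Function.update (1 : Fin m → I) j t) := by
      ext z
      simp only [mem_Iic, Pi.le_def, mem_preimage]
      refine ⟨fun hz i => ?_, fun hz => by simpa using hz j⟩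
      by_cases hij : i = j
      · subst hij; simpa using hz
      · simpa [hij] using unitInterval.le_one'
    rw [hset, hval, h.sklarCopula_eq_archimedeanFn hη, hη.archimedeanFn_update]
  · rw [measureReal_def, hval, ENNReal.toReal_ofReal]
    rw [h.sklarCopula_radialCDF hη]
    exact hC.radialCDF_nonneg (by omega) hS _

theorem isStrictArchimedean_sklarCopula (hC : IsStrictArchimedean C ψ) (hl : 1 ≤ l) (hm : 2 ≤ m)
    {S : ℝ} (hS : 0 < S) : IsStrictArchimedean
      (sklarCopula (m := m) (radialCDF ψ (altDeriv ψ l) S)) (condGenerator ψ l S) where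
  isCopula := hC.isCopula_sklarCopula hl hm hS
  isGenerator := (hC.isStrictGenerator_condGenerator hm hS).toIsGenerator
  strict := (hC.isStrictGenerator_condGenerator hm hS).strict
  eq_archimedeanFn := hC.isStrictGenerator.sklarCopula_eq_archimedeanFn
    (hC.isStrictGenerator_condGenerator hm hS)

theorem isCopulaOf_sklarCopula (hC : IsStrictArchimedean C ψ) (hl : 1 ≤ l) (hm : 2 ≤ m) {S : ℝ}
    (hS : 0 < S) : IsCopulaOf (m := m) (sklarCopula (radialCDF ψ (altDeriv ψ l) S))
      (radialCDF ψ (altDeriv ψ l) S) := by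
  have h := hC.isStrictGenerator
  have hη := hC.isStrictGenerator_condGenerator hm hS
  refine ⟨hC.isCopula_sklarCopula hl hm hS, fun y u hyu => ?_⟩
  have hu : u = fun j => genTransform ψ (condGenerator ψ l S) id (y j) := by
    ext j
    rw [hyu j, h.margin_radialCDF hη]
  rw [hu, h.sklarCopula_radialCDF hη]
  congr 1
  ext1 j
  exact le_antisymm ((h.genTransform_le_iff hη _ _).1 le_rfl)
    ((hη.genTransform_le_iff h _ _).2 le_rfl)

variable {x : Fin l → I}

theorem condCopula_eq (hC : IsStrictArchimedean C ψ) (hl : 1 ≤ l) (hm : 2 ≤ m)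
    (hx : ∀ i, x i ∈ Ioo 0 1) : condCopula ψ x =
      sklarCopula (m := m) (radialCDF ψ (altDeriv ψ l) (invSum ψ x)) := by
  rw [condCopula, hC.archCondCDF_eq hl hm hx]

theorem isStrictArchimedean_condCopula (hC : IsStrictArchimedean C ψ) (hl : 1 ≤ l) (hm : 2 ≤ m)
    (hx : ∀ i, x i ∈ Ioo 0 1) :
    IsStrictArchimedean (condCopula (m := m) ψ x) (condGenerator ψ l (invSum ψ x)) := by
  rw [hC.condCopula_eq hl hm hx]
  exact hC.isStrictArchimedean_sklarCopula hl hm (invSum_pos hC.isStrictGenerator hl hx)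

theorem isCopulaOf_condCopula (hC : IsStrictArchimedean C ψ) (hl : 1 ≤ l) (hm : 2 ≤ m)
    (hx : ∀ i, x i ∈ Ioo 0 1) : IsCopulaOf (m := m) (condCopula ψ x) (archCondCDF ψ x) := by
  rw [hC.condCopula_eq hl hm hx, hC.archCondCDF_eq hl hm hx]
  exact hC.isCopulaOf_sklarCopula hl hm (invSum_pos hC.isStrictGenerator hl hx)

theorem exists_markovKernel_archCondCDF (hC : IsStrictArchimedean C ψ) (hl : 1 ≤ l) (hm : 2 ≤ m) :
    ∃ K : Kernel (Fin l → I) (Fin m → I), IsMarkovKernelOf C K ∧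
      ∀ x, (∀ i, x i ∈ Ioo 0 1) → ∀ y, (K x).real (Iic y) = archCondCDF ψ x y := by
  obtain ⟨K, hK, hval⟩ := hC.exists_kernel hl hm
  refine ⟨K, hK, fun x hx y => ?_⟩
  have hS := invSum_pos hC.isStrictGenerator hl hx
  rw [measureReal_def, hval x hS, ENNReal.toReal_ofReal (hC.radialCDF_nonneg (by omega) hS y),
    hC.archCondCDF_eq hl hm hx]

end IsStrictArchimedean

/-! ### Scaling of generators -/

theorem IsStrictGenerator.toIsStrictArchimedean {d : ℕ} {C : (Fin d → I) → ℝ} {ψ : ℝ → ℝ}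
    (h : IsStrictGenerator ψ) (hC : IsCopula C) (heq : ∀ z, C z = archimedeanFn ψ z) :
    IsStrictArchimedean C ψ := ⟨hC, h.toIsGenerator, h.strict, heq⟩

namespace IsStrictGenerator

variable {ψ : ℝ → ℝ}

theorem scale (h : IsStrictGenerator ψ) {c : ℝ} (hc : 0 < c) :
    IsStrictGenerator fun z => ψ (c * z) := by
  have hmaps : ∀ {z : ℝ}, 0 ≤ z → c * z ∈ Ici (0 : ℝ) := fun hz => mul_nonneg hc.le hz
  have hlt : StrictAntiOn (fun z => ψ (c * z)) (Ici 0) := fun a ha b hb hab =>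
    h.strictAnti (hmaps ha) (hmaps hb) (mul_lt_mul_of_pos_left hab hc)
  refine ⟨⟨h.continuousOn.comp (by fun_prop) fun z hz => hmaps hz, hlt.antitoneOn, ?_,
    h.tendsto_zero.comp (tendsto_id.const_mul_atTop hc), hlt.mono fun z hz => hz.1⟩,
    fun z hz => h.strict _ (hmaps hz)⟩
  simp [h.map_zero]

theorem pseudoInv_scale (h : IsStrictGenerator ψ) {c : ℝ} (hc : 0 < c) {t : I} (ht : t ≠ 0) :
    pseudoInv (fun z => ψ (c * z)) t = pseudoInv ψ t / c := by
  have h1 := (h.scale hc).pseudoInv_apply (z := pseudoInv ψ t / c)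
    (div_nonneg (pseudoInv_nonneg _ _) hc.le)
  simp only [mul_div_cancel₀ _ hc.ne'] at h1
  rwa [h.apply_pseudoInv (unitInterval.pos_iff_ne_zero.2 ht) t.2.2] at h1

theorem archimedeanFn_scale (h : IsStrictGenerator ψ) {c : ℝ} (hc : 0 < c) {d : ℕ}
    (z : Fin d → I) : archimedeanFn (fun z => ψ (c * z)) z = archimedeanFn ψ z := by
  rw [archimedeanFn, archimedeanFn]
  split_ifs with hz
  · rfl
  · push Not at hz
    rw [Finset.sum_congr rfl fun i _ => h.pseudoInv_scale hc (hz i), ← Finset.sum_div,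
      mul_div_cancel₀ _ hc.ne']

theorem _root_.ArchCopula.iteratedDeriv_scale (c : ℝ) (ψ : ℝ → ℝ) (l : ℕ) (z : ℝ) :
    iteratedDeriv l (fun z => ψ (c * z)) z = c ^ l * iteratedDeriv l ψ (c * z) := by
  induction l generalizing z with
  | zero => simp
  | succ l ih =>
    rw [iteratedDeriv_succ, iteratedDeriv_succ, funext ih, deriv_const_mul_field,
      deriv_comp_mul_left c (iteratedDeriv l ψ) z, smul_eq_mul, pow_succ]
    ring

theorem archCondCDF_scale (h : IsStrictGenerator ψ) {c : ℝ} (hc : 0 < c) {l m : ℕ} {x : Fin l → I}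
    (hx : ∀ i, x i ≠ 0) (y : Fin m → I) :
    archCondCDF (fun z => ψ (c * z)) x y = archCondCDF ψ x y := by
  rw [archCondCDF, archCondCDF]
  split_ifs with hy
  · rfl
  · push Not at hy
    rw [Finset.sum_congr rfl fun i _ => h.pseudoInv_scale hc (hx i),
      Finset.sum_congr rfl fun i _ => h.pseudoInv_scale hc (hy i), ← Finset.sum_div,
      ← Finset.sum_div, iteratedDeriv_scale, iteratedDeriv_scale, ← add_div,
      mul_div_cancel₀ _ hc.ne', mul_div_cancel₀ _ hc.ne', mul_div_mul_left _ _ (by positivity)]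

theorem condCopula_scale (h : IsStrictGenerator ψ) {c : ℝ} (hc : 0 < c) {l m : ℕ} {x : Fin l → I}
    (hx : ∀ i, x i ≠ 0) : condCopula (m := m) (fun z => ψ (c * z)) x = condCopula ψ x := by
  rw [condCopula, condCopula, funext fun y => h.archCondCDF_scale hc hx y]

end IsStrictGenerator

theorem IsStrictArchimedean.scale {d : ℕ} {C : (Fin d → I) → ℝ} {ψ : ℝ → ℝ}
    (hC : IsStrictArchimedean C ψ) {c : ℝ} (hc : 0 < c) :
    IsStrictArchimedean C fun z => ψ (c * z) :=
  (hC.isStrictGenerator.scale hc).toIsStrictArchimedean hC.isCopula fun z => by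
    rw [hC.isStrictGenerator.archimedeanFn_scale hc, hC.eq_archimedeanFn]

/-! ### Convergence of normalised generators -/

section Convergence

variable {ψ : ℝ → ℝ} {ψn : ℕ → ℝ → ℝ}

theorem tendsto_pseudoInv (h : IsStrictGenerator ψ) (hn : ∀ n, IsStrictGenerator (ψn n))
    (hlim : ∀ z, 0 ≤ z → Tendsto (fun n => ψn n z) atTop (𝓝 (ψ z))) {t : ℕ → ℝ} {t₀ : ℝ}
    (ht : Tendsto t atTop (𝓝 t₀)) (ht₀ : 0 < t₀) (htn : ∀ n, 0 < t n ∧ t n ≤ 1) :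
    Tendsto (fun n => pseudoInv (ψn n) (t n)) atTop (𝓝 (pseudoInv ψ t₀)) := by
  have ht₁ : t₀ ≤ 1 := le_of_tendsto' ht fun n => (htn n).2
  refine tendsto_order.2 ⟨fun y hy => ?_, fun y hy => ?_⟩
  · rcases lt_or_ge y 0 with hy0 | hy0
    · exact Eventually.of_forall fun n => hy0.trans_le (pseudoInv_nonneg _ _)
    · have h1 : t₀ < ψ y := by
        rw [← h.apply_pseudoInv ht₀ ht₁]
        exact h.strictAnti hy0 (pseudoInv_nonneg _ _) hy
      filter_upwards [ht.eventually_lt (hlim y hy0) h1] with n h2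
      rw [← (hn n).apply_pseudoInv (htn n).1 (htn n).2] at h2
      exact ((hn n).strictAnti.lt_iff_gt (pseudoInv_nonneg _ _) hy0).1 h2
  · have hy0 : 0 ≤ y := (pseudoInv_nonneg _ _).trans hy.le
    have h1 : ψ y < t₀ := by
      rw [← h.apply_pseudoInv ht₀ ht₁]
      exact h.strictAnti (pseudoInv_nonneg _ _) hy0 hy
    filter_upwards [(hlim y hy0).eventually_lt ht h1] with n h2
    rw [← (hn n).apply_pseudoInv (htn n).1 (htn n).2] at h2
    exact ((hn n).strictAnti.lt_iff_gt hy0 (pseudoInv_nonneg _ _)).1 h2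

theorem IsStrictGenerator.tendsto_apply (h : IsStrictGenerator ψ) {z : ℕ → ℝ} {z₀ : ℝ}
    (hz : Tendsto z atTop (𝓝 z₀)) (hz0 : ∀ n, 0 ≤ z n) :
    Tendsto (fun n => ψ (z n)) atTop (𝓝 (ψ z₀)) :=
  (h.continuousOn z₀ (ge_of_tendsto' hz hz0)).tendsto.comp
    (tendsto_nhdsWithin_iff.2 ⟨hz, Eventually.of_forall hz0⟩)

variable {d : ℕ} {C : (Fin (d + 2) → I) → ℝ} {Cn : ℕ → (Fin (d + 2) → I) → ℝ}

theorem IsStrictArchimedean.apply_pair (hC : IsStrictArchimedean C ψ) {s t : I} (hs : s ≠ 0)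
    (ht : t ≠ 0) : C (Fin.cons s (Fin.cons t 1)) = ψ (pseudoInv ψ s + pseudoInv ψ t) := by
  rw [hC.eq_archimedeanFn, archimedeanFn, if_neg, Fin.sum_univ_succ, Fin.sum_univ_succ]
  · simp [hC.isStrictGenerator.pseudoInv_one]
  · rintro ⟨i, hi⟩
    revert hi
    refine Fin.cases (by simpa using hs) (fun i => ?_) i
    refine Fin.cases (by simpa using ht) (fun i => by simp) i

theorem tendsto_generator_add (hC : IsStrictArchimedean C ψ)
    (hCn : ∀ n, IsStrictArchimedean (Cn n) (ψn n)) (hconv : TendstoUniformly Cn C atTop) {a b : ℝ}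
    (ha : 0 ≤ a) (hb : 0 ≤ b) (hla : Tendsto (fun n => ψn n a) atTop (𝓝 (ψ a)))
    (hlb : Tendsto (fun n => ψn n b) atTop (𝓝 (ψ b))) :
    Tendsto (fun n => ψn n (a + b)) atTop (𝓝 (ψ (a + b))) := by
  have h := hC.isStrictGenerator
  have hn := fun n => (hCn n).isStrictGenerator
  let w : ℕ → Fin (d + 2) → I := fun n =>
    Fin.cons (genUnit (ψn n) a) (Fin.cons (genUnit (ψn n) b) 1)
  have hw : ∀ n, Cn n (w n) = ψn n (a + b) := fun n => by
    rw [(hCn n).apply_pair ((hn n).genUnit_pos a).ne' ((hn n).genUnit_pos b).ne',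
      (hn n).pseudoInv_genUnit ha, (hn n).pseudoInv_genUnit hb]
  have hinv : ∀ c, 0 ≤ c → Tendsto (fun n => ψn n c) atTop (𝓝 (ψ c)) →
      Tendsto (fun n => pseudoInv ψ (ψn n c)) atTop (𝓝 c) := fun c hc hlc => by
    have := tendsto_pseudoInv h (fun _ => h) (fun z _ => tendsto_const_nhds) hlc (h.pos hc)
      fun n => ⟨(hn n).pos hc, (hn n).le_one hc⟩
    rwa [h.pseudoInv_apply hc] at this
  have hCw : Tendsto (fun n => C (w n)) atTop (𝓝 (ψ (a + b))) := by
    have : ∀ n, C (w n) = ψ (pseudoInv ψ (ψn n a) + pseudoInv ψ (ψn n b)) := fun n => by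
      rw [hC.apply_pair ((hn n).genUnit_pos a).ne' ((hn n).genUnit_pos b).ne',
        (hn n).coe_genUnit ha, (hn n).coe_genUnit hb]
    simp only [this]
    exact h.tendsto_apply ((hinv a ha hla).add (hinv b hb hlb))
      fun n => add_nonneg (pseudoInv_nonneg _ _) (pseudoInv_nonneg _ _)
  have hdiff : Tendsto (fun n => Cn n (w n) - C (w n)) atTop (𝓝 0) := by
    rw [Metric.tendsto_atTop]
    intro ε hε
    obtain ⟨N, hN⟩ := eventually_atTop.1 (Metric.tendstoUniformly_iff.1 hconv ε hε)
    refine ⟨N, fun n hn => ?_⟩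
    have := hN n hn (w n)
    rw [dist_comm, Real.dist_eq] at this
    rwa [Real.dist_eq, sub_zero]
  simpa [hw] using hdiff.add hCw

theorem tendsto_generator_half (hC : IsStrictArchimedean C ψ)
    (hCn : ∀ n, IsStrictArchimedean (Cn n) (ψn n))
    (hconv : ∀ u, Tendsto (fun n => Cn n u) atTop (𝓝 (C u))) {a : ℝ}
    (ha : 0 ≤ a) (hla : Tendsto (fun n => ψn n (a + a)) atTop (𝓝 (ψ (a + a)))) :
    Tendsto (fun n => ψn n a) atTop (𝓝 (ψ a)) := by
  have h := hC.isStrictGenerator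
  have hn := fun n => (hCn n).isStrictGenerator
  have hdiag : ∀ s : I, s ≠ 0 → Tendsto
      (fun n => ψn n (pseudoInv (ψn n) s + pseudoInv (ψn n) s)) atTop
      (𝓝 (ψ (pseudoInv ψ s + pseudoInv ψ s))) := fun s hs => by
    rw [← hC.apply_pair hs hs]
    simpa only [(hCn _).apply_pair hs hs] using hconv (Fin.cons s (Fin.cons s 1))
  have hdouble : ∀ {η : ℝ → ℝ}, IsStrictGenerator η → ∀ {b c : ℝ}, 0 ≤ b → 0 ≤ c →
      (η (b + b) < η (c + c) ↔ c < b) := fun hη b c hb hc => by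
    rw [hη.strictAnti.lt_iff_gt (mem_Ici.2 (by positivity)) (mem_Ici.2 (by positivity))]
    constructor <;> intro <;> linarith
  refine tendsto_order.2 ⟨fun y hy => ?_, fun y hy => ?_⟩
  · rcases le_or_gt y 0 with hy0 | hy0
    · exact Eventually.of_forall fun n => hy0.trans_lt ((hn n).pos ha)
    · set s : I := ⟨y, hy0.le, hy.le.trans (h.le_one ha)⟩
      have hs : s ≠ 0 := unitInterval.pos_iff_ne_zero.1 hy0
      have h1 : a < pseudoInv ψ s := by
        rwa [← h.strictAnti.lt_iff_gt (pseudoInv_nonneg _ _) ha, h.apply_pseudoInv hy0 s.2.2]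
      filter_upwards [(hdiag s hs).eventually_lt hla
        ((hdouble h (pseudoInv_nonneg _ _) ha).2 h1)] with n h2
      have h3 := (hdouble (hn n) (pseudoInv_nonneg _ _) ha).1 h2
      rwa [← (hn n).strictAnti.lt_iff_gt (pseudoInv_nonneg _ _) ha,
        (hn n).apply_pseudoInv hy0 s.2.2] at h3
  · rcases lt_or_ge 1 y with hy1 | hy1
    · exact Eventually.of_forall fun n => ((hn n).le_one ha).trans_lt hy1
    · have hy0 : 0 < y := (h.pos ha).trans hy
      set s : I := ⟨y, hy0.le, hy1⟩
      have hs : s ≠ 0 := unitInterval.pos_iff_ne_zero.1 hy0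
      have h1 : pseudoInv ψ s < a := by
        rwa [← h.strictAnti.lt_iff_gt ha (pseudoInv_nonneg _ _), h.apply_pseudoInv hy0 s.2.2]
      filter_upwards [hla.eventually_lt (hdiag s hs)
        ((hdouble h ha (pseudoInv_nonneg _ _)).2 h1)] with n h2
      have h3 := (hdouble (hn n) ha (pseudoInv_nonneg _ _)).1 h2
      rwa [← (hn n).strictAnti.lt_iff_gt ha (pseudoInv_nonneg _ _),
        (hn n).apply_pseudoInv hy0 s.2.2] at h3

theorem tendsto_generator (hC : IsStrictArchimedean C ψ)
    (hCn : ∀ n, IsStrictArchimedean (Cn n) (ψn n)) (hconv : TendstoUniformly Cn C atTop)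
    (h1 : Tendsto (fun n => ψn n 1) atTop (𝓝 (ψ 1))) {z : ℝ} (hz : 0 ≤ z) :
    Tendsto (fun n => ψn n z) atTop (𝓝 (ψ z)) := by
  have h := hC.isStrictGenerator
  have hn := fun n => (hCn n).isStrictGenerator
  have hpow : ∀ j : ℕ, Tendsto (fun n => ψn n (1 / 2 ^ j)) atTop (𝓝 (ψ (1 / 2 ^ j))) := fun j => by
    induction j with
    | zero => simpa using h1
    | succ j ih =>
      refine tendsto_generator_half hC hCn (fun u => hconv.tendsto_at u) (by positivity) ?_
      rwa [show (1 : ℝ) / 2 ^ (j + 1) + 1 / 2 ^ (j + 1) = 1 / 2 ^ j by field_simp; ring]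
  have hdyad : ∀ (j i : ℕ), Tendsto (fun n => ψn n (i / 2 ^ j)) atTop (𝓝 (ψ (i / 2 ^ j))) :=
    fun j i => by
      induction i with
      | zero =>
        simp only [Nat.cast_zero, zero_div, h.map_zero, (hn _).map_zero]
        exact tendsto_const_nhds
      | succ i ih =>
        rw [Nat.cast_succ, add_div]
        exact tendsto_generator_add hC hCn hconv (by positivity) (by positivity) ih (hpow j)
  have hp : Tendsto (fun j : ℕ => (2 : ℝ) ^ j) atTop atTop :=
    tendsto_pow_atTop_atTop_of_one_lt one_lt_two
  have hlow : Tendsto (fun j : ℕ => ((⌊z * 2 ^ j⌋₊ : ℕ) : ℝ) / 2 ^ j) atTop (𝓝 z) :=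
    (tendsto_nat_floor_mul_div_atTop hz).comp hp
  have hupp : Tendsto (fun j : ℕ => ((⌊z * 2 ^ j⌋₊ + 1 : ℕ) : ℝ) / 2 ^ j) atTop (𝓝 z) := by
    have := hlow.add (tendsto_const_nhds.div_atTop hp : Tendsto (fun j : ℕ => (1 : ℝ) / 2 ^ j) _ _)
    rw [add_zero] at this
    refine this.congr fun j => ?_
    rw [Nat.cast_succ, add_div]
  refine tendsto_order.2 ⟨fun y hy => ?_, fun y hy => ?_⟩
  · obtain ⟨j, hj⟩ := ((h.tendsto_apply hupp fun j => by positivity).eventually_const_lt hy).exists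
    filter_upwards [(hdyad j _).eventually_const_lt hj] with n h2
    refine h2.trans_le ((hn n).antitoneOn hz (mem_Ici.2 (by positivity)) ?_)
    rw [le_div_iff₀ (by positivity)]
    exact_mod_cast (Nat.lt_floor_add_one _).le
  · obtain ⟨j, hj⟩ := ((h.tendsto_apply hlow fun j => by positivity).eventually_lt_const hy).exists
    filter_upwards [(hdyad j _).eventually_lt_const hj] with n h2
    refine lt_of_le_of_lt ((hn n).antitoneOn (mem_Ici.2 (by positivity)) hz ?_) h2
    rw [div_le_iff₀ (by positivity)]
    exact Nat.floor_le (by positivity)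

/-- The generators of the conditional copulas converge. -/
theorem tendsto_condGenerator {l m : ℕ} {C : (Fin (l + m) → I) → ℝ}
    {Cn : ℕ → (Fin (l + m) → I) → ℝ} (hl : 1 ≤ l) (hm : 2 ≤ m) (hC : IsStrictArchimedean C ψ)
    (hCn : ∀ n, IsStrictArchimedean (Cn n) (ψn n))
    (hlim : ∀ z, 0 ≤ z → Tendsto (fun n => ψn n z) atTop (𝓝 (ψ z))) {x : Fin l → I}
    (hx : ∀ i, x i ∈ Ioo 0 1) {z : ℝ} (hz : 0 ≤ z) :
    Tendsto (fun n => condGenerator (ψn n) l (invSum (ψn n) x) z) atTop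
      (𝓝 (condGenerator ψ l (invSum ψ x) z)) := by
  have h := hC.isStrictGenerator
  have hn := fun n => (hCn n).isStrictGenerator
  have hψ := hC.isMultiplyMonotone (by omega)
  have hS : 0 < invSum ψ x := IsStrictArchimedean.invSum_pos h hl hx
  have hSn : Tendsto (fun n => invSum (ψn n) x) atTop (𝓝 (invSum ψ x)) :=
    tendsto_finsetSum _ fun i _ => tendsto_pseudoInv h hn hlim tendsto_const_nhds
      (hx i).1 fun n => ⟨(hx i).1, (x i).2.2⟩
  obtain ⟨j, rfl⟩ := Nat.exists_eq_add_of_le' hl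
  have key : ∀ w, 0 ≤ w → Tendsto (fun n => altDeriv (ψn n) (j + 1) (invSum (ψn n) x + w)) atTop
      (𝓝 (altDeriv ψ (j + 1) (invSum ψ x + w))) := fun w hw => by
    have hpos : 0 < invSum ψ x + w := by positivity
    have h2 : IsMultiplyMonotone (0 + 2) (altDeriv ψ (j + 1)) :=
      IsMultiplyMonotone.altDeriv (n := 1) (hψ.mono (by omega))
    exact IsMultiplyMonotone.tendsto_altDeriv_succ_comp (j := j)
      (fun n => ((hCn n).isMultiplyMonotone (by omega)).mono (by omega)) (hψ.mono (by omega))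
      (fun t ht => hlim t ht.le) hpos (hSn.add_const w)
      (h2.continuousOn.continuousAt (Ioi_mem_nhds hpos))
  refine (key z hz).div (by simpa using key 0 le_rfl) (ne_of_gt ?_)
  exact (hψ.mono (by omega)).altDeriv_pos h.tendsto_zero (fun t ht => h.pos ht.le) hS

end Convergence

/-! ### Weak convergence from distribution functions -/

theorem tendsto_probabilityMeasure_of_tendsto_Iic {μ : ℕ → ProbabilityMeasure (Fin 1 → I)}
    {ν : ProbabilityMeasure (Fin 1 → I)} {Q : Set I} (hQ : Dense Q)
    (h : ∀ q ∈ Q, Tendsto (fun n => (μ n : Measure (Fin 1 → I)) (Iic fun _ => q)) atTop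
      (𝓝 ((ν : Measure (Fin 1 → I)) (Iic fun _ => q)))) : Tendsto μ atTop (𝓝 ν) := by
  let 𝓑 : Set (Set (Fin 1 → I)) := {∅, univ} ∪ (fun q => Iic fun _ => q) '' Q
  have hmeas : ∀ B ∈ 𝓑, MeasurableSet B := by
    rintro B ((rfl | rfl) | ⟨q, -, rfl⟩)
    exacts [.empty, .univ, measurableSet_Iic]
  have htotal : ∀ B ∈ 𝓑, ∀ E ∈ 𝓑, B ⊆ E ∨ E ⊆ B := by
    rintro B ((rfl | rfl) | ⟨q, -, rfl⟩) E ((rfl | rfl) | ⟨r, -, rfl⟩)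
    any_goals simp
    rcases le_total q r with hqr | hqr
    · exact .inl fun _ => hqr
    · exact .inr fun _ => hqr
  have hinter : ∀ B ∈ 𝓑, ∀ E ∈ 𝓑, B ∩ E ∈ 𝓑 := fun B hB E hE => by
    rcases htotal B hB E hE with hs | hs
    · rwa [inter_eq_left.2 hs]
    · rwa [inter_eq_right.2 hs]
  have hunion : ∀ B ∈ 𝓑, ∀ E ∈ 𝓑, B ∪ E ∈ 𝓑 := fun B hB E hE => by
    rcases htotal B hB E hE with hs | hs
    · rwa [union_eq_right.2 hs]
    · rwa [union_eq_left.2 hs]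
  have hlim : ∀ B ∈ 𝓑, Tendsto (fun n => (μ n : Measure (Fin 1 → I)).real B) atTop
      (𝓝 ((ν : Measure (Fin 1 → I)).real B)) := by
    rintro B ((rfl | rfl) | ⟨q, hq, rfl⟩)
    · simp
    · simp
    · exact (ENNReal.tendsto_toReal (measure_ne_top _ _)).comp (h q hq)
  refine IsPiSystem.tendsto_probabilityMeasure_of_tendsto_of_mem
    (S := {s | ∃ B ∈ 𝓑, ∃ E ∈ 𝓑, s = B \ E}) ?_ ?_ ?_ ?_
  · rintro _ ⟨B, hB, E, hE, rfl⟩ _ ⟨B', hB', E', hE', rfl⟩ _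
    refine ⟨B ∩ B', hinter _ hB _ hB', E ∪ E', hunion _ hE _ hE', ?_⟩
    ext
    simp only [mem_inter_iff, Set.mem_sdiff, mem_union]
    tauto
  · rintro _ ⟨B, hB, E, hE, rfl⟩
    exact (hmeas B hB).diff (hmeas E hE)
  · intro u hu x hx
    have hxc : ∀ t : Fin 1 → I, t = fun _ => t 0 := fun t => by
      ext i; rw [Subsingleton.elim i 0]
    have hU : {t : I | (fun _ => t : Fin 1 → I) ∈ u} ∈ 𝓝 (x 0) := by
      refine (hu.preimage (continuous_pi fun _ => continuous_id)).mem_nhds ?_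
      change (fun _ => x 0) ∈ u
      rwa [← hxc x]
    have hright : ∃ B ∈ 𝓑, B ∈ 𝓝 x ∧ ∀ t ∈ B, x 0 ≤ t 0 → t ∈ u := by
      rcases eq_or_ne (x 0) 1 with h1 | h1
      · refine ⟨univ, .inl (.inr rfl), univ_mem, fun t _ ht => ?_⟩
        rw [h1] at ht
        have : t = x := by
          rw [hxc t, hxc x, le_antisymm unitInterval.le_one' ht, h1]
        rwa [this]
      · obtain ⟨r, hr, hru⟩ := exists_Ico_subset_of_mem_nhds hU
          ⟨1, unitInterval.lt_one_iff_ne_one.2 h1⟩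
        obtain ⟨q, hq, hxq, hqr⟩ := hQ.exists_between hr
        refine ⟨Iic fun _ => q, .inr ⟨q, hq, rfl⟩, ?_, fun t ht hxt => ?_⟩
        · filter_upwards [(isOpen_Iio.preimage (continuous_apply (0 : Fin 1))).mem_nhds
            (show x ∈ (fun t : Fin 1 → I => t 0) ⁻¹' Iio q from hxq)] with t ht i
          rw [Subsingleton.elim i 0]
          exact le_of_lt ht
        · rw [hxc t]
          exact hru ⟨hxt, (ht 0).trans_lt hqr⟩
    have hleft : ∃ E ∈ 𝓑, Eᶜ ∈ 𝓝 x ∧ ∀ t, t ∉ E → t 0 ≤ x 0 → t ∈ u := by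
      rcases eq_or_ne (x 0) 0 with h1 | h1
      · refine ⟨∅, .inl (.inl rfl), by simp, fun t _ ht => ?_⟩
        rw [h1] at ht
        have : t = x := by
          rw [hxc t, hxc x, le_antisymm ht unitInterval.nonneg', h1]
        rwa [this]
      · obtain ⟨r, hr, hru⟩ := exists_Ioc_subset_of_mem_nhds hU
          ⟨0, unitInterval.pos_iff_ne_zero.2 h1⟩
        obtain ⟨q, hq, hrq, hqx⟩ := hQ.exists_between hr
        have hE : ∀ t : Fin 1 → I, t ∈ (Iic fun _ => q)ᶜ ↔ q < t 0 := fun t => by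
          simp [Pi.le_def, Fin.forall_fin_one]
        refine ⟨Iic fun _ => q, .inr ⟨q, hq, rfl⟩, ?_, fun t ht hxt => ?_⟩
        · filter_upwards [(isOpen_Ioi.preimage (continuous_apply (0 : Fin 1))).mem_nhds
            (show x ∈ (fun t : Fin 1 → I => t 0) ⁻¹' Ioi q from hqx)] with t ht
          exact (hE t).2 ht
        · rw [hxc t]
          exact hru ⟨hrq.trans ((hE t).1 ht), hxt⟩
    obtain ⟨B, hB, hBx, hBu⟩ := hright
    obtain ⟨E, hE, hEx, hEu⟩ := hleft
    refine ⟨B \ E, ⟨B, hB, E, hE, rfl⟩, inter_mem hBx hEx, fun t ht => ?_⟩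
    rcases le_total (x 0) (t 0) with hxt | hxt
    · exact hBu t ht.1 hxt
    · exact hEu t ht.2 hxt
  · rintro _ ⟨B, hB, E, hE, rfl⟩
    have hdiff : ∀ κ : ProbabilityMeasure (Fin 1 → I), (κ : Measure (Fin 1 → I)).real (B \ E) =
        (κ : Measure (Fin 1 → I)).real B - (κ : Measure (Fin 1 → I)).real (B ∩ E) := fun κ => by
      rw [← sdiff_self_inter, measureReal_sdiff inter_subset_left (hmeas _ (hinter _ hB _ hE))]
    have := (hlim B hB).sub (hlim _ (hinter B hB E hE))
    simp only [← hdiff] at this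
    exact NNReal.tendsto_coe.1 this

/-! ### Convergence of densities -/

/-- Scheffé's lemma. -/
theorem tendsto_integral_abs_sub {α : Type*} [MeasurableSpace α] {μ : Measure α}
    {u : ℕ → α → ℝ} {v : α → ℝ} (hu : ∀ n, Integrable (u n) μ) (hv : Integrable v μ)
    (hu0 : ∀ n, 0 ≤ᵐ[μ] u n) (hlim : ∀ᵐ x ∂μ, Tendsto (fun n => u n x) atTop (𝓝 (v x)))
    (hint : Tendsto (fun n => ∫ x, u n x ∂μ) atTop (𝓝 (∫ x, v x ∂μ))) :
    Tendsto (fun n => ∫ x, |u n x - v x| ∂μ) atTop (𝓝 0) := by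
  have hpos : ∀ n, Integrable (fun x => max (v x - u n x) 0) μ := fun n => (hv.sub (hu n)).pos_part
  have h1 : ∀ n, ∫ x, |u n x - v x| ∂μ =
      (∫ x, u n x ∂μ - ∫ x, v x ∂μ) + 2 * ∫ x, max (v x - u n x) 0 ∂μ := fun n => by
    rw [← integral_sub (hu n) hv, ← integral_const_mul, ← integral_add (f := fun x => u n x - v x)
      ((hu n).sub hv) ((hpos n).const_mul 2)]
    congr 1
    ext x
    rcases le_total (u n x) (v x) with h | h
    · rw [abs_of_nonpos (by linarith), max_eq_left (by linarith)]
      ring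
    · rw [abs_of_nonneg (by linarith), max_eq_right (by linarith)]
      ring
  have h2 : Tendsto (fun n => ∫ x, max (v x - u n x) 0 ∂μ) atTop (𝓝 (∫ _, 0 ∂μ)) := by
    refine tendsto_integral_of_dominated_convergence (fun x => |v x|)
      (fun n => (hpos n).aestronglyMeasurable) hv.abs (fun n => ?_) ?_
    · filter_upwards [hu0 n] with x hx
      have hx : 0 ≤ u n x := hx
      rw [Real.norm_of_nonneg (le_max_right _ _)]
      exact max_le (by linarith [le_abs_self (v x)]) (abs_nonneg _)
    · filter_upwards [hlim] with x hx
      simpa using (hx.const_sub (v x)).max (tendsto_const_nhds (x := (0 : ℝ)))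
  simp only [h1]
  simpa using (hint.sub_const (∫ x, v x ∂μ)).add (h2.const_mul 2)

theorem ae_sum_add_notMem {k : ℕ} (hk : 1 ≤ k) {N : Set ℝ} (hN : N.Countable) (b : ℝ) :
    ∀ᵐ z ∂orthantMeasure k, ∑ i, z i + b ∉ N := by
  refine ae_restrict_of_ae ?_
  let L : (Fin k → ℝ) →ₗ[ℝ] ℝ := ∑ i, LinearMap.proj i
  have hL : ∀ z, L z = ∑ i, z i := fun z => by simp [L]
  have hsurj : Function.Surjective L := fun t => ⟨Pi.single ⟨0, hk⟩ t, by
    rw [hL, Finset.sum_pi_single' _ t, if_pos (Finset.mem_univ _)]⟩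
  have hN' : ((fun t => t + b) ⁻¹' N).Countable := hN.preimage (add_left_injective b)
  have := (ae_comp_linearMap_mem_iff (μ := (volume : Measure (Fin k → ℝ))) (ν := volume) L hsurj
    hN'.measurableSet.compl).2 (hN'.ae_notMem _)
  filter_upwards [this] with z hz
  rw [hL] at hz
  exact hz

/-- The points of discontinuity of an antitone function on `(0, ∞)`. -/
theorem countable_not_continuousAt_of_antitoneOn {f : ℝ → ℝ} (hf : AntitoneOn f (Ioi 0)) :
    {t : ℝ | 0 < t ∧ ¬ContinuousAt f t}.Countable := by
  refine hf.countable_not_continuousWithinAt.mono ?_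
  exact fun t ht => ⟨ht.1, fun hc => ht.2 (hc.continuousAt (Ioi_mem_nhds ht.1))⟩

section

variable {k : ℕ} {D : (Fin (k + 1) → I) → ℝ} {η : ℝ → ℝ}

theorem IsStrictArchimedean.ae_continuousAt_sum (hD : IsStrictArchimedean D η) (hk : 1 ≤ k) {b : ℝ}
    (hb : 0 ≤ b) : ∀ᵐ z ∂orthantMeasure k, ContinuousAt (altDeriv η k) (∑ i, z i + b) := by
  have hmono : IsMultiplyMonotone (0 + 1) (altDeriv η k) :=
    IsMultiplyMonotone.altDeriv (n := 0) ((hD.isMultiplyMonotone (by omega)).mono (by omega))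
  filter_upwards [ae_sum_add_notMem hk (countable_not_continuousAt_of_antitoneOn hmono.antitoneOn) b,
    ae_orthantMeasure_pos k] with z hz hz0
  by_contra hc
  exact hz ⟨add_pos_of_pos_of_nonneg
    (Finset.sum_pos (fun i _ => hz0 i) ⟨⟨0, hk⟩, Finset.mem_univ _⟩) hb, hc⟩

theorem IsStrictArchimedean.ae_continuousAt_invSum (hD : IsStrictArchimedean D η) (hk : 1 ≤ k)
    {b : ℝ} (hb : 0 ≤ b) :
    ∀ᵐ s : Fin k → I, ContinuousAt (altDeriv η k) (invSum η s + b) := by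
  have h := hD.isStrictGenerator
  have hm : MeasurableSet {s : Fin k → I | ContinuousAt (altDeriv η k) (invSum η s + b)} :=
    (measurableSet_of_continuousAt (altDeriv η k)).preimage (h.measurable_invSum.add_const b)
  refine (h.volume_absolutelyContinuous_map
    ((hD.isMultiplyMonotone (by omega)).mono (by omega))).ae_le ?_
  refine (ae_map_iff h.measurable_genCube.aemeasurable hm).2 ?_
  filter_upwards [hD.ae_continuousAt_sum hk hb, ae_orthantMeasure_pos k] with z hz hz0
  rwa [h.invSum_genCube fun i => (hz0 i).le]

theorem ae_ne_zero_cube : ∀ᵐ s : Fin k → I, ∀ i, s i ≠ 0 := by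
  refine ae_all_iff.2 fun i => ?_
  have h1 : ∀ᵐ t ∂(volume : Measure I), t ≠ 0 := by simp [ae_iff]
  exact (Measure.quasiMeasurePreserving_eval (μ := fun _ : Fin k => (volume : Measure I)) i).ae h1

variable {Dn : ℕ → (Fin (k + 1) → I) → ℝ} {ηn : ℕ → ℝ → ℝ}

theorem tendsto_altDeriv_of_continuousAt (hD : IsStrictArchimedean D η)
    (hDn : ∀ n, IsStrictArchimedean (Dn n) (ηn n)) (hk : 1 ≤ k)
    (hlim : ∀ z, 0 ≤ z → Tendsto (fun n => ηn n z) atTop (𝓝 (η z))) {s : ℕ → ℝ} {t : ℝ}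
    (ht : 0 < t) (hs : Tendsto s atTop (𝓝 t)) (hc : ContinuousAt (altDeriv η k) t) :
    Tendsto (fun n => altDeriv (ηn n) k (s n)) atTop (𝓝 (altDeriv η k t)) := by
  obtain ⟨j, rfl⟩ := Nat.exists_eq_add_of_le' hk
  exact IsMultiplyMonotone.tendsto_altDeriv_succ_comp (j := j)
    (fun n => ((hDn n).isMultiplyMonotone (by omega)).mono (by omega))
    ((hD.isMultiplyMonotone (by omega)).mono (by omega)) (fun z hz => hlim z hz.le) ht hs hc

/-- The convergence of the distribution functions of the Markov kernels. -/
theorem tendsto_radialCDF (hD : IsStrictArchimedean D η)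
    (hDn : ∀ n, IsStrictArchimedean (Dn n) (ηn n)) (hk : 1 ≤ k)
    (hlim : ∀ z, 0 ≤ z → Tendsto (fun n => ηn n z) atTop (𝓝 (η z))) {s : Fin k → I}
    (hs : ∀ i, s i ≠ 0) (hs0 : 0 < invSum η s) (hc0 : ContinuousAt (altDeriv η k) (invSum η s))
    {v : Fin 1 → I} (hc : ContinuousAt (altDeriv η k) (invSum η s + invSum η v)) :
    Tendsto (fun n => radialCDF (ηn n) (altDeriv (ηn n) k) (invSum (ηn n) s) v) atTop
      (𝓝 (radialCDF η (altDeriv η k) (invSum η s) v)) := by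
  have hinv : ∀ {j : ℕ} {u : Fin j → I}, (∀ i, u i ≠ 0) →
      Tendsto (fun n => invSum (ηn n) u) atTop (𝓝 (invSum η u)) := fun hu =>
    tendsto_finsetSum _ fun i _ => tendsto_pseudoInv hD.isStrictGenerator
      (fun n => (hDn n).isStrictGenerator) hlim tendsto_const_nhds
      (unitInterval.pos_iff_ne_zero.2 (hu i)) fun _ =>
        ⟨unitInterval.pos_iff_ne_zero.2 (hu i), unitInterval.le_one _⟩
  unfold radialCDF
  split_ifs with hv
  · exact tendsto_const_nhds
  · push Not at hv
    refine (tendsto_altDeriv_of_continuousAt hD hDn hk hlim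
      (add_pos_of_pos_of_nonneg hs0 (invSum_nonneg η v)) ((hinv hs).add (hinv hv)) hc).div
      (tendsto_altDeriv_of_continuousAt hD hDn hk hlim hs0 (hinv hs) hc0) (ne_of_gt ?_)
    exact ((hD.isMultiplyMonotone (by omega)).mono (by omega)).altDeriv_pos
      hD.isStrictGenerator.tendsto_zero (fun t ht => hD.isStrictGenerator.pos ht.le) hs0

theorem weaklyConditionallyConverges_of_tendsto (hD : IsStrictArchimedean D η)
    (hDn : ∀ n, IsStrictArchimedean (Dn n) (ηn n)) (hk : 1 ≤ k)
    (hlim : ∀ z, 0 ≤ z → Tendsto (fun n => ηn n z) atTop (𝓝 (η z))) :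
    WeaklyConditionallyConverges (l := k) (m := 1) Dn D := by
  intro Kn K hKn hK
  obtain ⟨Q, hQc, hQd⟩ := TopologicalSpace.exists_countable_dense I
  have hKM := hK.isMarkovKernel
  have hKnM := fun n => (hKn n).isMarkovKernel
  have h1 : ∀ᵐ s : Fin k → I, ∀ q ∈ Q, K s (Iic fun _ => q) =
      ENNReal.ofReal (radialCDF η (altDeriv η k) (invSum η s) fun _ : Fin 1 => q) :=
    (ae_ball_iff hQc).2 fun q _ => (hD.isMarkovKernelOf_iff hk le_rfl K).1 hK _
  have h2 : ∀ᵐ s : Fin k → I, ∀ n, ∀ q ∈ Q, Kn n s (Iic fun _ => q) =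
      ENNReal.ofReal (radialCDF (ηn n) (altDeriv (ηn n) k) (invSum (ηn n) s) fun _ : Fin 1 => q) :=
    ae_all_iff.2 fun n => (ae_ball_iff hQc).2 fun q _ =>
      ((hDn n).isMarkovKernelOf_iff hk le_rfl (Kn n)).1 (hKn n) _
  have h3 : ∀ᵐ s : Fin k → I, ∀ q ∈ Q,
      ContinuousAt (altDeriv η k) (invSum η s + invSum η fun _ : Fin 1 => q) :=
    (ae_ball_iff hQc).2 fun q _ => hD.ae_continuousAt_invSum hk (invSum_nonneg _ _)
  have h4 : ∀ᵐ s : Fin k → I, ContinuousAt (altDeriv η k) (invSum η s + 0) :=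
    hD.ae_continuousAt_invSum hk le_rfl
  have hmain : ∀ᵐ s : Fin k → I, Tendsto (fun n => kernelAt (Kn n) (hKn n).isMarkovKernel s) atTop
      (𝓝 (kernelAt K hK.isMarkovKernel s)) := by
    filter_upwards [h1, h2, h3, h4, ae_ne_zero_cube, hD.ae_invSum_pos hk le_rfl] with
      s h1 h2 h3 h4 h5 h6
    rw [add_zero] at h4
    refine tendsto_probabilityMeasure_of_tendsto_Iic hQd fun q hq => ?_
    have := ENNReal.tendsto_ofReal (tendsto_radialCDF hD hDn hk hlim h5 h6 h4 (h3 q hq))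
    rw [← h1 q hq] at this
    exact this.congr fun n => (h2 n q hq).symm
  have hprob : IsProbabilityMeasure (marginalMeasure (l := k) (m := 1) D) := by
    have := hD.isCopula.isDStochastic.isProbabilityMeasure
    exact Measure.isProbabilityMeasure_map
      IsStrictArchimedean.measurable_firstBlock.aemeasurable
  have hnull := (hD.marginalMeasure_absolutelyContinuous hk le_rfl).ae_le hmain
  refine ⟨(toMeasurable (marginalMeasure (l := k) (m := 1) D) {s | ¬Tendsto (fun n =>
    kernelAt (Kn n) (hKn n).isMarkovKernel s) atTop (𝓝 (kernelAt K hK.isMarkovKernel s))})ᶜ,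
    (measurableSet_toMeasurable _ _).compl, ?_, fun s hs => ?_⟩
  · rw [prob_compl_eq_one_iff (measurableSet_toMeasurable _ _), measure_toMeasurable]
    exact hnull
  · by_contra hc
    exact hs (subset_toMeasurable _ _ hc)

end

/-! ### Convergence of the dependence measure -/

section

variable {k : ℕ} {D : (Fin (k + 1) → I) → ℝ} {η : ℝ → ℝ}

theorem IsStrictArchimedean.altDeriv_sum_add_nonneg (hD : IsStrictArchimedean D η) (hk : 1 ≤ k)
    {b : ℝ} (hb : 0 ≤ b) : 0 ≤ᵐ[orthantMeasure k] fun z => altDeriv η k (∑ i, z i + b) := by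
  filter_upwards [ae_orthantMeasure_pos k] with z hz
  exact (((hD.isMultiplyMonotone (by omega)).mono (by omega)).altDeriv_pos
    hD.isStrictGenerator.tendsto_zero (fun t ht => hD.isStrictGenerator.pos ht.le)
    (add_pos_of_pos_of_nonneg
      (Finset.sum_pos (fun i _ => hz i) ⟨⟨0, hk⟩, Finset.mem_univ _⟩) hb)).le

theorem IsStrictArchimedean.lintegral_altDeriv_sum_add (hD : IsStrictArchimedean D η)
    {b : ℝ} (hb : 0 ≤ b) :
    ∫⁻ z, ENNReal.ofReal (altDeriv η k (∑ i, z i + b)) ∂orthantMeasure k =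
      ENNReal.ofReal (η b) := by
  have := hD.isStrictGenerator.setLIntegral_pi_altDeriv (j := k)
    ((hD.isMultiplyMonotone (by omega)).mono (by omega)) (a := fun _ => 0) (fun _ => le_rfl) hb
  simpa [orthantMeasure] using this

theorem IsStrictArchimedean.integrable_altDeriv_sum_add (hD : IsStrictArchimedean D η) (hk : 1 ≤ k)
    {b : ℝ} (hb : 0 ≤ b) :
    Integrable (fun z => altDeriv η k (∑ i, z i + b)) (orthantMeasure k) := by
  refine ⟨(IsStrictGenerator.measurable_altDeriv_sum η hk b).aestronglyMeasurable, ?_⟩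
  rw [hasFiniteIntegral_iff_ofReal (hD.altDeriv_sum_add_nonneg hk hb),
    hD.lintegral_altDeriv_sum_add hb]
  exact ENNReal.ofReal_lt_top

theorem IsStrictArchimedean.integral_altDeriv_sum_add (hD : IsStrictArchimedean D η) (hk : 1 ≤ k)
    {b : ℝ} (hb : 0 ≤ b) :
    ∫ z, altDeriv η k (∑ i, z i + b) ∂orthantMeasure k = η b := by
  rw [integral_eq_lintegral_of_nonneg_ae (hD.altDeriv_sum_add_nonneg hk hb)
    (hD.integrable_altDeriv_sum_add hk hb).aestronglyMeasurable, hD.lintegral_altDeriv_sum_add hb,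
    ENNReal.toReal_ofReal (hD.isStrictGenerator.pos hb).le]

/-- The inner integral of `zeta1`, in the coordinates `z = φ(s)`. -/
noncomputable def zetaIntegral (η : ℝ → ℝ) (k : ℕ) (y : I) : ℝ :=
  ∫ z, |altDeriv η k (∑ i, z i + pseudoInv η y) - y * altDeriv η k (∑ i, z i + 0)| ∂orthantMeasure k

theorem IsStrictArchimedean.integral_condDistrib_eq (hD : IsStrictArchimedean D η) (hk : 1 ≤ k)
    {y : I} (hy : y ≠ 0) :
    ∫ s : Fin k → I, |(condDistrib (lastBlock (l := k) (m := 1)) firstBlock (copulaMeasure D) s).real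
        {t : Fin 1 → I | t 0 ≤ y} - (y : ℝ)| ∂(marginalMeasure (l := k) (m := 1) D) =
      zetaIntegral η k y := by
  have h := hD.isStrictGenerator
  set K := condDistrib (lastBlock (l := k) (m := 1)) firstBlock (copulaMeasure D) with hK
  have hMK : IsMarkovKernelOf (l := k) (m := 1) D K := by
    refine ⟨inferInstance, (measurable_firstBlock.prodMk measurable_lastBlock).aemeasurable, ?_⟩
    rw [hK, compProd_map_condDistrib measurable_lastBlock.aemeasurable]
  have hset : {t : Fin 1 → I | t 0 ≤ y} = Iic fun _ => y := by
    ext t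
    simp [Pi.le_def, Fin.forall_fin_one]
  have h1 := (hD.isMarkovKernelOf_iff hk le_rfl K).1 hMK fun _ => y
  have h2 : ∀ᵐ s ∂(marginalMeasure (l := k) (m := 1) D),
      |(K s).real {t : Fin 1 → I | t 0 ≤ y} - (y : ℝ)| =
      |radialCDF η (altDeriv η k) (invSum η s) (fun _ : Fin 1 => y) - y| := by
    filter_upwards [(hD.marginalMeasure_absolutelyContinuous hk le_rfl).ae_le h1,
      (hD.marginalMeasure_absolutelyContinuous hk le_rfl).ae_le (hD.ae_invSum_pos hk le_rfl)]
      with s hs hs0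
    rw [hset, measureReal_def, hs,
      ENNReal.toReal_ofReal (IsStrictArchimedean.radialCDF_nonneg (l := k) (m := 1) hD le_rfl hs0 _)]
  have hmR := (IsStrictArchimedean.measurable_radialCDF (l := k) (m := 1) hD hk fun _ => y)
  have hd := IsStrictGenerator.measurable_altDeriv_sum η hk 0
  simp only [add_zero] at hd
  rw [integral_congr_ae h2, hD.marginalMeasure_eq hk le_rfl, integral_map
    h.measurable_genCube.aemeasurable (hmR.sub_const _).abs.aestronglyMeasurable, radialMeasure,
    integral_withDensity_eq_integral_toReal_smul hd.ennreal_ofReal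
      (Eventually.of_forall fun _ => ENNReal.ofReal_lt_top), zetaIntegral]
  refine integral_congr_ae ?_
  filter_upwards [ae_orthantMeasure_pos k] with z hz
  have hpos := h.altDeriv_sum_pos ((hD.isMultiplyMonotone (by omega)).mono (by omega)) hk hz
  rw [h.invSum_genCube fun i => (hz i).le, radialCDF, if_neg (by simpa using hy),
    ENNReal.toReal_ofReal hpos.le, smul_eq_mul, add_zero]
  nth_rw 1 [← abs_of_pos hpos]
  rw [← abs_mul, mul_sub, mul_div_cancel₀ _ hpos.ne', mul_comm _ (y : ℝ)]
  simp [invSum]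

theorem IsStrictArchimedean.zeta1_eq (hD : IsStrictArchimedean D η) (hk : 1 ≤ k) :
    zeta1 D = 3 * ∫ y : I, zetaIntegral η k y := by
  rw [zeta1]
  congr 1
  refine integral_congr_ae ?_
  have h1 : ∀ᵐ y ∂(volume : Measure I), y ≠ 0 := by simp [ae_iff]
  filter_upwards [h1] with y hy using hD.integral_condDistrib_eq hk hy

theorem IsStrictArchimedean.measurable_zetaIntegral (hD : IsStrictArchimedean D η) (hk : 1 ≤ k) :
    StronglyMeasurable (zetaIntegral η k) := by
  have hsf : SFinite (orthantMeasure k) := by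
    unfold orthantMeasure
    infer_instance
  have hm := measurable_altDeriv η hk
  have hφ := hD.isStrictGenerator.measurable_pseudoInv
  have hs : Measurable fun p : I × (Fin k → ℝ) => ∑ i, p.2 i := by fun_prop
  refine StronglyMeasurable.integral_prod_right (f := fun (y : I) (z : Fin k → ℝ) =>
    |altDeriv η k (∑ i, z i + pseudoInv η y) - y * altDeriv η k (∑ i, z i + 0)|) ?_
  refine Measurable.stronglyMeasurable (Measurable.abs (Measurable.sub ?_ (Measurable.mul ?_ ?_)))
  · exact hm.comp (hs.add (hφ.comp measurable_fst))
  · exact measurable_subtype_coe.comp measurable_fst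
  · exact hm.comp (hs.add_const 0)

theorem IsStrictArchimedean.abs_zetaIntegral_le (hD : IsStrictArchimedean D η) (hk : 1 ≤ k)
    (y : I) : ‖zetaIntegral η k y‖ ≤ 2 := by
  have h := hD.isStrictGenerator
  have h1 := hD.integrable_altDeriv_sum_add hk (pseudoInv_nonneg η y)
  have h2 := (hD.integrable_altDeriv_sum_add hk le_rfl).const_mul (y : ℝ)
  rw [zetaIntegral, Real.norm_of_nonneg (integral_nonneg fun _ => abs_nonneg _)]
  calc ∫ z, |altDeriv η k (∑ i, z i + pseudoInv η y) - y * altDeriv η k (∑ i, z i + 0)|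
        ∂orthantMeasure k
      ≤ ∫ z, (altDeriv η k (∑ i, z i + pseudoInv η y) + y * altDeriv η k (∑ i, z i + 0))
        ∂orthantMeasure k := by
        refine integral_mono_ae (h1.sub h2).abs (h1.add h2) ?_
        filter_upwards [hD.altDeriv_sum_add_nonneg hk (pseudoInv_nonneg η y),
          hD.altDeriv_sum_add_nonneg hk le_rfl] with z hz1 hz2
        have hz1 : 0 ≤ altDeriv η k (∑ i, z i + pseudoInv η y) := hz1
        have hz2 : 0 ≤ (y : ℝ) * altDeriv η k (∑ i, z i + 0) := mul_nonneg y.2.1 hz2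
        exact abs_le.2 ⟨by linarith, by linarith⟩
    _ = η (pseudoInv η y) + y * η 0 := by
        rw [integral_add h1 h2, integral_const_mul, hD.integral_altDeriv_sum_add hk le_rfl,
          hD.integral_altDeriv_sum_add hk (pseudoInv_nonneg η y)]
    _ ≤ 1 + 1 * 1 := by
        have := h.le_one (pseudoInv_nonneg η y)
        have := h.le_one le_rfl
        have := (h.pos le_rfl).le
        have := y.2.2
        gcongr
    _ = 2 := by norm_num

variable {Dn : ℕ → (Fin (k + 1) → I) → ℝ} {ηn : ℕ → ℝ → ℝ}

theorem tendsto_integral_abs_altDeriv_sub (hD : IsStrictArchimedean D η)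
    (hDn : ∀ n, IsStrictArchimedean (Dn n) (ηn n)) (hk : 1 ≤ k)
    (hlim : ∀ z, 0 ≤ z → Tendsto (fun n => ηn n z) atTop (𝓝 (η z))) {b : ℕ → ℝ} {b₀ : ℝ}
    (hb : ∀ n, 0 ≤ b n) (hbb : Tendsto b atTop (𝓝 b₀))
    (hint : Tendsto (fun n => ηn n (b n)) atTop (𝓝 (η b₀))) :
    Tendsto (fun n => ∫ z, |altDeriv (ηn n) k (∑ i, z i + b n) - altDeriv η k (∑ i, z i + b₀)|
      ∂orthantMeasure k) atTop (𝓝 0) := by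
  have hb₀ : 0 ≤ b₀ := ge_of_tendsto' hbb hb
  refine tendsto_integral_abs_sub (fun n => (hDn n).integrable_altDeriv_sum_add hk (hb n))
    (hD.integrable_altDeriv_sum_add hk hb₀) (fun n => (hDn n).altDeriv_sum_add_nonneg hk (hb n)) ?_ ?_
  · filter_upwards [hD.ae_continuousAt_sum hk hb₀, ae_orthantMeasure_pos k] with z hz hz0
    exact tendsto_altDeriv_of_continuousAt hD hDn hk hlim (add_pos_of_pos_of_nonneg
      (Finset.sum_pos (fun i _ => hz0 i) ⟨⟨0, hk⟩, Finset.mem_univ _⟩) hb₀) (hbb.const_add _) hz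
  · rw [hD.integral_altDeriv_sum_add hk hb₀]
    exact hint.congr fun n => ((hDn n).integral_altDeriv_sum_add hk (hb n)).symm

theorem tendsto_zetaIntegral (hD : IsStrictArchimedean D η)
    (hDn : ∀ n, IsStrictArchimedean (Dn n) (ηn n)) (hk : 1 ≤ k)
    (hlim : ∀ z, 0 ≤ z → Tendsto (fun n => ηn n z) atTop (𝓝 (η z))) {y : I} (hy : y ≠ 0) :
    Tendsto (fun n => zetaIntegral (ηn n) k y) atTop (𝓝 (zetaIntegral η k y)) := by
  have h := hD.isStrictGenerator
  have hn := fun n => (hDn n).isStrictGenerator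
  have hy0 : 0 < (y : ℝ) := unitInterval.pos_iff_ne_zero.2 hy
  have hφ : Tendsto (fun n => pseudoInv (ηn n) y) atTop (𝓝 (pseudoInv η y)) :=
    tendsto_pseudoInv h hn hlim tendsto_const_nhds hy0 fun _ => ⟨hy0, y.2.2⟩
  have l1 := tendsto_integral_abs_altDeriv_sub hD hDn hk hlim
    (fun n => pseudoInv_nonneg (ηn n) y) hφ (by
      simp only [h.apply_pseudoInv hy0 y.2.2, (hn _).apply_pseudoInv hy0 y.2.2]
      exact tendsto_const_nhds)
  have l2 := tendsto_integral_abs_altDeriv_sub hD hDn hk hlim (b := fun _ => 0)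
    (fun n => le_rfl) tendsto_const_nhds (hlim 0 le_rfl)
  have l3 := l1.add (l2.const_mul (y : ℝ))
  rw [mul_zero, add_zero] at l3
  rw [tendsto_iff_norm_sub_tendsto_zero]
  refine squeeze_zero (fun _ => norm_nonneg _) (fun n => ?_) l3
  have i1 := hD.integrable_altDeriv_sum_add hk (pseudoInv_nonneg η y)
  have i2 := hD.integrable_altDeriv_sum_add hk le_rfl
  have j1 := (hDn n).integrable_altDeriv_sum_add hk (pseudoInv_nonneg (ηn n) y)
  have j2 := (hDn n).integrable_altDeriv_sum_add hk le_rfl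
  have e1 : Integrable (fun z => |altDeriv (ηn n) k (∑ i, z i + pseudoInv (ηn n) y) -
      y * altDeriv (ηn n) k (∑ i, z i + 0)|) (orthantMeasure k) := (j1.sub (j2.const_mul _)).abs
  have e2 : Integrable (fun z => |altDeriv η k (∑ i, z i + pseudoInv η y) -
      y * altDeriv η k (∑ i, z i + 0)|) (orthantMeasure k) := (i1.sub (i2.const_mul _)).abs
  have e3 : Integrable (fun z => |altDeriv (ηn n) k (∑ i, z i + pseudoInv (ηn n) y) -
      altDeriv η k (∑ i, z i + pseudoInv η y)|) (orthantMeasure k) := (j1.sub i1).abs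
  have e4 : Integrable (fun z => (y : ℝ) * |altDeriv (ηn n) k (∑ i, z i + 0) -
      altDeriv η k (∑ i, z i + 0)|) (orthantMeasure k) := (j2.sub i2).abs.const_mul _
  rw [zetaIntegral, zetaIntegral, ← integral_sub e1 e2, ← integral_const_mul,
    ← integral_add e3 e4]
  refine norm_integral_le_of_norm_le (e3.add e4) (Eventually.of_forall fun z => ?_)
  generalize altDeriv (ηn n) k (∑ i, z i + pseudoInv (ηn n) y) = p
  generalize altDeriv (ηn n) k (∑ i, z i + 0) = q
  generalize altDeriv η k (∑ i, z i + pseudoInv η y) = r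
  generalize altDeriv η k (∑ i, z i + 0) = t
  calc ‖|p - y * q| - |r - y * t|‖ ≤ |(p - y * q) - (r - y * t)| := abs_abs_sub_abs_le _ _
    _ = |(p - r) - y * (q - t)| := by congr 1; ring
    _ ≤ |p - r| + |y * (q - t)| := abs_sub _ _
    _ = |p - r| + y * |q - t| := by rw [abs_mul, abs_of_pos hy0]

theorem tendsto_zeta1 (hD : IsStrictArchimedean D η)
    (hDn : ∀ n, IsStrictArchimedean (Dn n) (ηn n)) (hk : 1 ≤ k)
    (hlim : ∀ z, 0 ≤ z → Tendsto (fun n => ηn n z) atTop (𝓝 (η z))) :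
    Tendsto (fun n => zeta1 (Dn n)) atTop (𝓝 (zeta1 D)) := by
  simp only [hD.zeta1_eq hk, (hDn _).zeta1_eq hk]
  refine Tendsto.const_mul 3 (tendsto_integral_of_dominated_convergence (fun _ => 2)
    (fun n => ((hDn n).measurable_zetaIntegral hk).aestronglyMeasurable) (integrable_const _)
    (fun n => Eventually.of_forall fun y => (hDn n).abs_zetaIntegral_le hk y) ?_)
  have h1 : ∀ᵐ y ∂(volume : Measure I), y ≠ 0 := by simp [ae_iff]
  filter_upwards [h1] with y hy using tendsto_zetaIntegral hD hDn hk hlim hy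

end

/-- The generator normalised by `ψ(1) = 1/2`. -/
noncomputable def normGenerator (ψ : ℝ → ℝ) (z : ℝ) : ℝ := ψ (pseudoInv ψ (1 / 2) * z)

theorem IsStrictGenerator.pseudoInv_half_pos {ψ : ℝ → ℝ} (h : IsStrictGenerator ψ) :
    0 < pseudoInv ψ (1 / 2) := by
  refine lt_of_le_of_ne (pseudoInv_nonneg _ _) fun h0 => ?_
  have := h.apply_pseudoInv (t := 1 / 2) (by norm_num) (by norm_num)
  rw [← h0, h.map_zero] at this
  norm_num at this

theorem IsStrictGenerator.normGenerator_one {ψ : ℝ → ℝ} (h : IsStrictGenerator ψ) :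
    normGenerator ψ 1 = 1 / 2 := by
  rw [normGenerator, mul_one, h.apply_pseudoInv (by norm_num) (by norm_num)]

end ArchCopula

open ArchCopula in
theorem corollary6p2 (l k : ℕ) (hl : 1 ≤ l) (hk : 1 ≤ k)
    (C : (Fin (l + (k + 1)) → I) → ℝ) (Cn : ℕ → (Fin (l + (k + 1)) → I) → ℝ)
    (ψ : ℝ → ℝ) (ψn : ℕ → ℝ → ℝ)
    (hC : IsStrictArchimedean C ψ) (hCn : ∀ n, IsStrictArchimedean (Cn n) (ψn n))
    (hconv : TendstoUniformly Cn C atTop) :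
    -- the functions `archCondCDF` come from versions of the Markov kernels of the copulas
    (∃ K : Kernel (Fin l → I) (Fin (k + 1) → I), IsMarkovKernelOf C K ∧
      ∀ x, (∀ i, x i ∈ Ioo 0 1) → ∀ y, (K x).real (Iic y) = archCondCDF ψ x y) ∧
    (∀ n, ∃ K : Kernel (Fin l → I) (Fin (k + 1) → I), IsMarkovKernelOf (Cn n) K ∧
      ∀ x, (∀ i, x i ∈ Ioo 0 1) → ∀ y, (K x).real (Iic y) = archCondCDF (ψn n) x y) ∧
    ∀ x : Fin l → I, (∀ i, x i ∈ Ioo 0 1) →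
      -- the conditional copulas are the copulas of these distribution functions
      IsCopulaOf (m := k + 1) (condCopula ψ x) (archCondCDF ψ x) ∧
      (∀ n, IsCopulaOf (m := k + 1) (condCopula (ψn n) x) (archCondCDF (ψn n) x)) ∧
      -- the two convergence assertions
      WeaklyConditionallyConverges (l := k) (m := 1)
        (fun n => condCopula (ψn n) x) (condCopula ψ x) ∧
      Tendsto (fun n => |zeta1 (k := k) (condCopula (ψn n) x) - zeta1 (k := k) (condCopula ψ x)|)
        atTop (𝓝 0) := by
  have hm : 2 ≤ k + 1 := by omega
  refine ⟨hC.exists_markovKernel_archCondCDF hl hm,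
    fun n => (hCn n).exists_markovKernel_archCondCDF hl hm, fun x hx =>
    ⟨hC.isCopulaOf_condCopula hl hm hx, fun n => (hCn n).isCopulaOf_condCopula hl hm hx, ?_⟩⟩
  have hx0 : ∀ i, x i ≠ 0 := fun i => (hx i).1.ne'
  have hψ := hC.isStrictGenerator
  have hψn := fun n => (hCn n).isStrictGenerator
  have hN : IsStrictArchimedean C (normGenerator ψ) := hC.scale hψ.pseudoInv_half_pos
  have hNn : ∀ n, IsStrictArchimedean (Cn n) (normGenerator (ψn n)) := fun n =>
    (hCn n).scale (hψn n).pseudoInv_half_pos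
  have e : condCopula (m := k + 1) (normGenerator ψ) x = condCopula ψ x :=
    hψ.condCopula_scale hψ.pseudoInv_half_pos hx0
  have en : ∀ n, condCopula (m := k + 1) (normGenerator (ψn n)) x = condCopula (ψn n) x := fun n =>
    (hψn n).condCopula_scale (hψn n).pseudoInv_half_pos hx0
  obtain ⟨d, hd⟩ : ∃ d, l + (k + 1) = d + 2 := ⟨l + k - 1, by omega⟩
  have hlim : ∀ z, 0 ≤ z →
      Tendsto (fun n => normGenerator (ψn n) z) atTop (𝓝 (normGenerator ψ z)) := by
    intro z hz
    clear e en hx hx0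
    generalize l + (k + 1) = p at *
    subst hd
    refine tendsto_generator hN hNn hconv ?_ hz
    simp only [hψ.normGenerator_one, (hψn _).normGenerator_one]
    exact tendsto_const_nhds
  have hD := hN.isStrictArchimedean_condCopula hl hm hx
  have hDn := fun n => (hNn n).isStrictArchimedean_condCopula hl hm hx
  have hη := fun z (hz : 0 ≤ z) => tendsto_condGenerator hl hm hN hNn hlim hx hz
  rw [e] at hD
  simp only [en] at hDn
  refine ⟨weaklyConditionallyConverges_of_tendsto hD hDn hk hη, ?_⟩
  have := ((tendsto_zeta1 hD hDn hk hη).sub_const (zeta1 (k := k) (condCopula ψ x))).abs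
  simpa using this
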